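/- Let $S$ be an affine scheme. Work on the category $\mathrm{Sch}_S$ of all $S$-schemes with the fppf topology and its structure sheaf $\mathcal O\colon T\mapsto \Gamma(T,\mathcal O_T)$. Let $\mathcal A$ be an Azumaya $\mathcal O$-algebra, i.e. a finite locally free (unital, associative) $\mathcal O$-algebra such that $\mathcal A(U)$ is an Azumaya $\mathcal O(U)$-algebra for every affine $U\in\mathrm{Sch}_S$, and let $\operatorname{Trd}_{\mathcal A}\colon\mathcal A\to\mathcal O$ be its reduced trace. Let $\sigma$ be an orthogonal involution on $\mathcal A$: an $\mathcal O$-linear anti-automorphism with $\sigma^2=\mathrm{Id}$ such that, fppf-locally on $S$, $(\mathcal A,\sigma)$ is isomorphic to an endomorphism algebra $\mathcal End_{\mathcal O}(\mathcal O^n)$ with the adjoint involution of a regular symmetric bilinear form. Put $\mathcal Sym=\operatorname{Ker}(\mathrm{Id}-\sigma)$, and let $\mathcal Alt=\operatorname{Im}(\mathrm{Id}-\sigma)$ and $\mathcal Symd=\operatorname{Im}(\mathrm{Id}+\sigma)$ be the image fppf sheaves. Let $\xi\colon \mathcal A/\mathcal Alt\to\mathcal Symd$ be the map from the quotient fppf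 sheaf induced by $\mathrm{Id}+\sigma$, and write $\overline a\in(\mathcal A/\mathcal Alt)(S)$ for the class of $a\in\mathcal A(S)$. For a linear form (morphism of $\mathcal O$-modules) $f\colon\mathcal Sym\to\mathcal O$, call $(\mathcal A,\sigma,f)$ a quadratic triple if $f(a+\sigma(a))=\operatorname{Trd}_{\mathcal A}(a)$ for all $T\in\mathrm{Sch}_S$ and $a\in\mathcal A(T)$. (i) If $(\mathcal A,\sigma,f)$ is a quadratic triple, then there exists $\ell_f\in\mathcal A(S)$ with $\ell_f+\sigma(\ell_f)=1$ and $$f(s)=\operatorname{Trd}_{\mathcal A}(\ell_f|_T\cdot s)\quad\text{for all } T\in\mathrm{Sch}_S \text{ and } s\in\mathcal Sym(T).$$ In particular $1\in\mathcal Symd(S)$. (ii) Assume that $1\in\mathcal Symd(S)$. Then $\xi(S)^{-1}(1)\subseteq(\mathcal A/\mathcal Alt)(S)$ is non-empty, and the map $$\{f : (\mathcal A,\sigma,f)\text{ is a quadratic triple}\}\to\xi(S)^{-1}(1),\qquad f\mapsto\overline{\ell_f},$$ where $\ell_f$ is any element as in (i), is well defined and bijective. In particular, for a given quadratic triple $(\mathcal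 A,\sigma,f)$ the element $\ell_f$ is uniquely determined up to addition of an element of $\mathcal Alt(S)$, and adding any element of $\mathcal Alt(S)$ gives another such element. -/

import Mathlib

open CategoryTheory AlgebraicGeometry Opposite

universe u

namespace FppfAlg

/-! ### The ringed site of all `S`-schemes with the fppf topology -/

/-- The (big) fppf topology on the category `Over S` of all `S`-schemes. -/
abbrev fppf (S : Scheme.{u}) : GrothendieckTopology (Over S) :=
  Scheme.fppfTopology.over S

/-- The structure sheaf `𝒪 : T ↦ Γ(T, 𝒪_T)` on `S`-schemes. -/
abbrev structureSheaf (S : Scheme.{u}) : (Over S)ᵒᵖ ⥤ CommRingCat.{u} :=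
  (Over.forget S).op ⋙ Scheme.Γ

/-- The ring of sections `𝒪(T)`. -/
abbrev O {S : Scheme.{u}} (T : Over S) : Type u := (structureSheaf S).obj (op T)

/-- The restriction map `𝒪(T) → 𝒪(V)` along a morphism `V ⟶ T` of `S`-schemes. -/
def resO {S : Scheme.{u}} {V T : Over S} (g : V ⟶ T) : O T →+* O V :=
  ((structureSheaf S).map g.op).hom

/-- A unital associative `𝒪`-algebra: an fppf sheaf of (not necessarily commutative) rings on
`S`-schemes with a morphism from the structure sheaf whose image is central. -/
structure OAlgebra (S : Scheme.{u}) where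
  presheaf : (Over S)ᵒᵖ ⥤ RingCat.{u}
  isSheaf : Presieve.IsSheaf (fppf S) (presheaf ⋙ forget RingCat.{u})
  structureMap : structureSheaf S ⋙ forget₂ CommRingCat.{u} RingCat.{u} ⟶ presheaf
  central : ∀ (T : Over S) (r : O T) (a : presheaf.obj (op T)),
    (structureMap.app (op T)).hom r * a = a * (structureMap.app (op T)).hom r

namespace OAlgebra

variable {S : Scheme.{u}} (A : OAlgebra S)

/-- The ring of sections `𝒜(T)`. -/
def Sections (T : Over S) : Type u := A.presheaf.obj (op T)

instance (T : Over S) : Ring (A.Sections T) :=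
  inferInstanceAs (Ring (A.presheaf.obj (op T)))

instance (T : Over S) : Algebra (O T) (A.Sections T) :=
  RingHom.toAlgebra' (R := O T) (S := A.Sections T) (A.structureMap.app (op T)).hom
    (fun r a => A.central T r a)

/-- The restriction map `𝒜(T) → 𝒜(V)`, `a ↦ a|_V`, along a morphism `V ⟶ T`. -/
def res {V T : Over S} (g : V ⟶ T) : A.Sections T →+* A.Sections V :=
  (A.presheaf.map g.op).hom

theorem res_id (T : Over S) (a : A.Sections T) : A.res (𝟙 T) a = a := by
  change (A.presheaf.map (𝟙 (op T))).hom a = a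
  rw [A.presheaf.map_id]
  rfl

theorem res_comp {W V T : Over S} (h : W ⟶ V) (g : V ⟶ T) (a : A.Sections T) :
    A.res (h ≫ g) a = A.res h (A.res g a) := by
  change (A.presheaf.map (g.op ≫ h.op)).hom a = _
  rw [A.presheaf.map_comp]
  rfl

theorem res_algebraMap {V T : Over S} (g : V ⟶ T) (r : O T) :
    A.res g (algebraMap (O T) (A.Sections T) r) =
      algebraMap (O V) (A.Sections V) (resO g r) :=
  (ConcreteCategory.congr_hom (A.structureMap.naturality g.op) r).symm

theorem res_smul {V T : Over S} (g : V ⟶ T) (r : O T) (a : A.Sections T) :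
    A.res g (r • a) = resO g r • A.res g a := by
  rw [Algebra.smul_def, Algebra.smul_def, map_mul, res_algebraMap]

/-- Sections of `𝒜` that agree on a covering sieve are equal. -/
theorem eq_of_locally_eq {T : Over S} (R : Sieve T) (hR : R ∈ fppf S T) (a b : A.Sections T)
    (h : ∀ ⦃V : Over S⦄ (g : V ⟶ T), R g → A.res g a = A.res g b) : a = b :=
  (A.isSheaf R hR).isSeparatedFor.ext (fun _ g hg => h g hg)

/-- The final object `S` of the category of `S`-schemes. -/
abbrev base (S : Scheme.{u}) : Over S := Over.mk (𝟙 S)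

/-- The structure morphism `T ⟶ S`, as a morphism in the category of `S`-schemes. -/
noncomputable abbrev toBase (T : Over S) : T ⟶ base S := Over.mkIdTerminal.from T

/-! ### Azumaya algebras and the reduced trace -/

/-- An isomorphism of `𝒪|_T`-modules `𝒜|_T ≅ (𝒪|_T)ⁿ`. -/
structure Frame (T : Over S) (n : ℕ) where
  iso : ∀ ⦃V : Over S⦄ (_ : V ⟶ T), A.Sections V ≃ₗ[O V] (Fin n → O V)
  natural : ∀ ⦃W V : Over S⦄ (h : W ⟶ V) (g : V ⟶ T) (a : A.Sections V) (i : Fin n),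
    iso (h ≫ g) (A.res h a) i = resO h (iso g a i)

/-- `𝒜` is finite locally free as an `𝒪`-module: it is free of finite rank on the members of
some fppf covering of `S`. -/
def IsFiniteLocallyFree : Prop :=
  ∃ R ∈ fppf S (base S), ∀ ⦃T : Over S⦄ (g : T ⟶ base S), R g → ∃ n : ℕ, Nonempty (A.Frame T n)

/-- `𝒜` is an Azumaya `𝒪`-algebra: it is finite locally free and `𝒜(U)` is an Azumaya
`𝒪(U)`-algebra for every affine `S`-scheme `U`. -/
structure IsAzumayaAlgebra : Prop where
  finiteLocallyFree : A.IsFiniteLocallyFree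
  azumaya : ∀ U : Over S, IsAffine U.left → IsAzumaya (O U) (A.Sections U)

/-- An isomorphism of `𝒪|_T`-algebras `𝒜|_T ≅ ℰnd((𝒪|_T)ⁿ) = M_n(𝒪|_T)`. -/
structure Splitting (T : Over S) (n : ℕ) where
  iso : ∀ ⦃V : Over S⦄ (_ : V ⟶ T), A.Sections V ≃ₐ[O V] Matrix (Fin n) (Fin n) (O V)
  natural : ∀ ⦃W V : Over S⦄ (h : W ⟶ V) (g : V ⟶ T) (a : A.Sections V),
    iso (h ≫ g) (A.res h a) = (iso g a).map (resO h)

/-- `c ∈ 𝒪(T)` is the reduced trace of `a ∈ 𝒜(T)`: over each `V ⟶ T` on which `𝒜` is split,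
`c` restricts to the trace of the matrix corresponding to `a|_V`. -/
def IsReducedTrace {T : Over S} (a : A.Sections T) (c : O T) : Prop :=
  ∀ ⦃V : Over S⦄ (g : V ⟶ T) (n : ℕ) (φ : A.Splitting V n),
    (φ.iso (𝟙 V) (A.res g a)).trace = resO g c

open Classical in
/-- The reduced trace `Trd_𝒜(a)`: the unique section of `𝒪` that is the trace of `a` in every
local splitting of `𝒜` (such a section exists whenever `𝒜` is an Azumaya algebra). -/
noncomputable def trd {T : Over S} (a : A.Sections T) : O T :=
  if h : ∃! c : O T, A.IsReducedTrace a c then h.choose else 0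

/-! ### Image sheaves of module endomorphisms -/

/-- An endomorphism of the `𝒪`-module underlying `𝒜`. -/
structure ModuleEnd where
  app : ∀ T : Over S, A.Sections T →ₗ[O T] A.Sections T
  natural : ∀ ⦃V T : Over S⦄ (g : V ⟶ T) (a : A.Sections T),
    app V (A.res g a) = A.res g (app T a)

variable {A}

/-- The image fppf sheaf `Im(d) ⊆ 𝒜` of an endomorphism `d`: its sections over `T` are the
`x ∈ 𝒜(T)` such that `x|_V` is of the form `d(a)`, `a ∈ 𝒜(V)`, for all `V ⟶ T` in some
covering sieve of `T`. -/
def ModuleEnd.image (d : A.ModuleEnd) (T : Over S) : Submodule (O T) (A.Sections T) where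
  carrier := {x | ∃ R ∈ fppf S T, ∀ ⦃V : Over S⦄ (g : V ⟶ T), R g →
    ∃ a : A.Sections V, d.app V a = A.res g x}
  zero_mem' := ⟨⊤, (fppf S).top_mem T, fun _ _ _ => ⟨0, by simp⟩⟩
  add_mem' := by
    rintro x y ⟨R, hR, hx⟩ ⟨R', hR', hy⟩
    refine ⟨R ⊓ R', (fppf S).intersection_covering hR hR', fun V g hg => ?_⟩
    obtain ⟨a, ha⟩ := hx g hg.1
    obtain ⟨b, hb⟩ := hy g hg.2
    exact ⟨a + b, by rw [map_add, map_add, ha, hb]⟩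
  smul_mem' := by
    rintro r x ⟨R, hR, hx⟩
    refine ⟨R, hR, fun V g hg => ?_⟩
    obtain ⟨a, ha⟩ := hx g hg
    exact ⟨resO g r • a, by rw [map_smul, ha, res_smul]⟩

theorem ModuleEnd.res_mem_image (d : A.ModuleEnd) {V T : Over S} (g : V ⟶ T)
    {x : A.Sections T} (hx : x ∈ d.image T) : A.res g x ∈ d.image V := by
  obtain ⟨R, hR, h⟩ := hx
  refine ⟨R.pullback g, (fppf S).pullback_stable g hR, fun W k hk => ?_⟩
  obtain ⟨a, ha⟩ := h (k ≫ g) hk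
  exact ⟨a, by rw [ha, res_comp]⟩

/-- Membership in the image sheaf is a local property. -/
theorem ModuleEnd.mem_image_of_locally (d : A.ModuleEnd) {T : Over S} (x : A.Sections T)
    (R : Sieve T) (hR : R ∈ fppf S T)
    (h : ∀ ⦃V : Over S⦄ (g : V ⟶ T), R g → A.res g x ∈ d.image V) : x ∈ d.image T := by
  let R' : Sieve T :=
    { arrows := fun V g => ∃ a : A.Sections V, d.app V a = A.res g x
      downward_closed := by
        rintro V W g ⟨a, ha⟩ k
        exact ⟨A.res k a, by rw [d.natural, ha, res_comp]⟩ }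
  refine ⟨R', (fppf S).transitive hR R' fun V g hg => ?_, fun V g hg => hg⟩
  obtain ⟨Q, hQ, hq⟩ := h g hg
  refine (fppf S).superset_covering (fun W k hk => ?_) hQ
  obtain ⟨a, ha⟩ := hq k hk
  exact ⟨a, by rw [ha, res_comp]⟩

/-! ### Involutions of the first kind and the associated modules -/

variable (A)

/-- An involution of the first kind on `𝒜`: an `𝒪`-linear anti-automorphism `σ` with `σ² = Id`. -/
structure Involution extends A.ModuleEnd where
  map_mul : ∀ (T : Over S) (a b : A.Sections T), app T (a * b) = app T b * app T a
  involutive : ∀ (T : Over S) (a : A.Sections T), app T (app T a) = a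

variable {A}

namespace Involution

variable (σ : A.Involution)

/-- `σ` is orthogonal: fppf locally on `S`, `(𝒜, σ)` is isomorphic to `(ℰnd(𝒪ⁿ), η_b)` for a
regular symmetric bilinear form `b` on `𝒪ⁿ`, where `η_b` is the adjoint involution, determined by
`b(η_b(a) x, y) = b(x, a y)`. Here `b(x, y) = xᵀ G y` for a symmetric invertible matrix `G`. -/
def IsOrthogonal : Prop :=
  ∃ R ∈ fppf S (base S), ∀ ⦃T : Over S⦄ (g : T ⟶ base S), R g →
    ∃ (n : ℕ) (φ : A.Splitting T n) (G : Matrix (Fin n) (Fin n) (O T)),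
      G.IsSymm ∧ IsUnit G ∧
      ∀ ⦃V : Over S⦄ (h : V ⟶ T) (a : A.Sections V),
        (φ.iso h (σ.app V a)).transpose * G.map (resO h) = G.map (resO h) * φ.iso h a

/-- The endomorphism `Id - σ`. -/
def idSub : A.ModuleEnd where
  app T := LinearMap.id - σ.app T
  natural V T g a := by simp [σ.natural]

/-- The endomorphism `Id + σ`. -/
def idAdd : A.ModuleEnd where
  app T := LinearMap.id + σ.app T
  natural V T g a := by simp [σ.natural]

/-- The symmetric elements `𝒮ym(T) = Ker(Id - σ)(T)`. -/
def Sym (T : Over S) : Submodule (O T) (A.Sections T) := LinearMap.ker (σ.idSub.app T)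

/-- The alternating elements `𝒜ℓt = Im(Id - σ)`, an image fppf sheaf. -/
def Alt (T : Over S) : Submodule (O T) (A.Sections T) := σ.idSub.image T

/-- The symmetrized elements `𝒮ymd = Im(Id + σ)`, an image fppf sheaf. -/
def Symd (T : Over S) : Submodule (O T) (A.Sections T) := σ.idAdd.image T

theorem mem_Sym {T : Over S} (a : A.Sections T) : a ∈ σ.Sym T ↔ σ.app T a = a := by
  change a - σ.app T a = 0 ↔ _
  rw [sub_eq_zero, eq_comm]

theorem add_mem_Sym {T : Over S} (a : A.Sections T) : a + σ.app T a ∈ σ.Sym T := by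
  rw [mem_Sym, map_add, σ.involutive, add_comm]

theorem res_mem_Sym {V T : Over S} (g : V ⟶ T) {a : A.Sections T} (ha : a ∈ σ.Sym T) :
    A.res g a ∈ σ.Sym V := by
  rw [mem_Sym] at ha ⊢
  rw [σ.natural, ha]

/-- Alternating elements are skew-symmetric. -/
theorem add_eq_zero_of_mem_Alt {T : Over S} {x : A.Sections T} (hx : x ∈ σ.Alt T) :
    x + σ.app T x = 0 := by
  obtain ⟨R, hR, h⟩ := hx
  refine A.eq_of_locally_eq R hR _ _ fun V g hg => ?_
  obtain ⟨a, ha⟩ := h g hg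
  change a - σ.app V a = A.res g x at ha
  rw [map_add, ← σ.natural, ← ha, map_sub, σ.involutive, map_zero]
  abel

/-! ### The quotient sheaf `𝒜/𝒜ℓt` and the map `ξ` -/

/-- A representative of a section over `T` of the quotient sheaf `𝒜/𝒜ℓt`: a family of sections
of `𝒜` on a covering sieve of `T` that is compatible modulo `𝒜ℓt`. -/
structure QuotFamily (T : Over S) where
  sieve : Sieve T
  covering : sieve ∈ fppf S T
  val : ∀ ⦃V : Over S⦄ (g : V ⟶ T), sieve g → A.Sections V
  compatible : ∀ ⦃W V : Over S⦄ (k : W ⟶ V) (g : V ⟶ T) (hg : sieve g),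
    val (k ≫ g) (sieve.downward_closed hg k) - A.res k (val g hg) ∈ σ.Alt W

/-- Two families represent the same section of `𝒜/𝒜ℓt` if they agree modulo `𝒜ℓt` wherever both
are defined. -/
def quotSetoid (T : Over S) : Setoid (σ.QuotFamily T) where
  r x y := ∀ ⦃V : Over S⦄ (g : V ⟶ T) (hx : x.sieve g) (hy : y.sieve g),
    x.val g hx - y.val g hy ∈ σ.Alt V
  iseqv := by
    refine ⟨fun x V g _ _ => ?_, fun {x y} h V g hy hx => ?_, fun {x y z} hxy hyz V g hx hz => ?_⟩
    · rw [sub_self]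
      exact zero_mem _
    · rw [← neg_sub]
      exact neg_mem (h g hx hy)
    · refine σ.idSub.mem_image_of_locally _ (y.sieve.pullback g)
        ((fppf S).pullback_stable g y.covering) fun W k hk => ?_
      have hk' : y.sieve (k ≫ g) := hk
      have h1 := hxy (k ≫ g) (x.sieve.downward_closed hx k) hk'
      have h2 := hyz (k ≫ g) hk' (z.sieve.downward_closed hz k)
      have h3 := x.compatible k g hx
      have h4 := z.compatible k g hz
      have h5 := add_mem (sub_mem (add_mem h1 h2) h3) h4
      have e : A.res k (x.val g hx - z.val g hz) =
          x.val (k ≫ g) (x.sieve.downward_closed hx k) - y.val (k ≫ g) hk' +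
          (y.val (k ≫ g) hk' - z.val (k ≫ g) (z.sieve.downward_closed hz k)) -
          (x.val (k ≫ g) (x.sieve.downward_closed hx k) - A.res k (x.val g hx)) +
          (z.val (k ≫ g) (z.sieve.downward_closed hz k) - A.res k (z.val g hz)) := by
        rw [map_sub]
        abel
      rw [e]
      exact h5

/-- The set of sections `(𝒜/𝒜ℓt)(T)` of the quotient fppf sheaf (the sheafification of
`T ↦ 𝒜(T)/𝒜ℓt(T)`): families compatible modulo `𝒜ℓt` on a covering sieve, up to agreement
modulo `𝒜ℓt`. -/
def QuotAlt (T : Over S) : Type (u + 1) := Quotient (σ.quotSetoid T)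

/-- The quotient map `𝒜(T) → (𝒜/𝒜ℓt)(T)`, `a ↦ a̅`. -/
def toQuotAlt {T : Over S} (a : A.Sections T) : σ.QuotAlt T :=
  Quotient.mk (σ.quotSetoid T)
    { sieve := ⊤
      covering := (fppf S).top_mem T
      val := fun _ g _ => A.res g a
      compatible := fun W V k g _ => by
        rw [res_comp, sub_self]
        exact zero_mem _ }

/-- The image under `Id + σ` of a family representing a section of `𝒜/𝒜ℓt`. -/
def xiFamily {T : Over S} (x : σ.QuotFamily T) :
    Presieve.FamilyOfElements (A.presheaf ⋙ forget RingCat.{u}) x.sieve.arrows :=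
  fun V g hg => σ.idAdd.app V (x.val g hg)

theorem xiFamily_compatible {T : Over S} (x : σ.QuotFamily T) : (σ.xiFamily x).Compatible := by
  rw [Presieve.compatible_iff_sieveCompatible]
  intro V W g k hg
  have h := σ.add_eq_zero_of_mem_Alt (x.compatible k g hg)
  change σ.idAdd.app W (_ - _) = 0 at h
  rw [map_sub, sub_eq_zero, σ.idAdd.natural] at h
  exact h

/-- The section of `𝒜` obtained by gluing the sections `x_V + σ(x_V)`. -/
noncomputable def xiSection {T : Over S} (x : σ.QuotFamily T) : A.Sections T :=
  (A.isSheaf x.sieve x.covering).amalgamate (σ.xiFamily x) (σ.xiFamily_compatible x)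

theorem res_xiSection {T : Over S} (x : σ.QuotFamily T) {V : Over S} (g : V ⟶ T)
    (hg : x.sieve g) : A.res g (σ.xiSection x) = x.val g hg + σ.app V (x.val g hg) :=
  (A.isSheaf x.sieve x.covering).valid_glue (σ.xiFamily_compatible x) g hg

theorem xiSection_mem {T : Over S} (x : σ.QuotFamily T) : σ.xiSection x ∈ σ.Symd T :=
  ⟨x.sieve, x.covering, fun _ g hg => ⟨x.val g hg, (σ.res_xiSection x g hg).symm⟩⟩

/-- The map `ξ(T) : (𝒜/𝒜ℓt)(T) → 𝒮ymd(T)` induced by `Id + σ`. -/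
noncomputable def xi (T : Over S) : σ.QuotAlt T → σ.Symd T :=
  Quotient.lift (s := σ.quotSetoid T) (fun x => ⟨σ.xiSection x, σ.xiSection_mem x⟩) (by
    intro x y hxy
    apply Subtype.ext
    refine A.eq_of_locally_eq (x.sieve ⊓ y.sieve)
      ((fppf S).intersection_covering x.covering y.covering) _ _ fun V g hg => ?_
    rw [σ.res_xiSection x g hg.1, σ.res_xiSection y g hg.2, ← sub_eq_zero]
    have h := σ.add_eq_zero_of_mem_Alt (hxy g hg.1 hg.2)
    rw [map_sub] at h
    rw [← h]
    abel)

/-! ### Quadratic triples -/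

/-- A linear form `f : 𝒮ym → 𝒪`, i.e. a morphism of `𝒪`-modules. -/
structure SymForm where
  app : ∀ T : Over S, σ.Sym T →ₗ[O T] O T
  natural : ∀ ⦃V T : Over S⦄ (g : V ⟶ T) (s : σ.Sym T),
    app V ⟨A.res g s, σ.res_mem_Sym g s.2⟩ = resO g (app T s)

/-- `(𝒜, σ, f)` is a quadratic triple: `f(a + σ(a)) = Trd_𝒜(a)` for all sections `a` of `𝒜`
(where `𝒜` is an Azumaya algebra and `σ` an orthogonal involution). -/
def SymForm.IsQuadratic {σ : A.Involution} (f : σ.SymForm) : Prop :=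
  ∀ (T : Over S) (a : A.Sections T), f.app T ⟨a + σ.app T a, σ.add_mem_Sym a⟩ = A.trd a

/-- The section `ℓ ∈ 𝒜(S)` satisfies `ℓ + σ(ℓ) = 1` and represents the linear form `f`, that is,
`f(s) = Trd_𝒜(ℓ|_T · s)` for all `T` and `s ∈ 𝒮ym(T)`. -/
def SymForm.IsRepresentedBy {σ : A.Involution} (f : σ.SymForm) (l : A.Sections (base S)) : Prop :=
  l + σ.app (base S) l = 1 ∧
    ∀ (T : Over S) (s : σ.Sym T), f.app T s = A.trd (A.res (toBase T) l * (s : A.Sections T))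

end Involution

end OAlgebra

end FppfAlg

/-!
A quadratic form is represented by an element because `𝒮ym` and `𝒜ℓt` are orthogonal complements of
each other for the reduced trace form, and because all the linear equations involved can be solved
over an affine base as soon as they can be solved locally.

*Local computations.* Where `(𝒜, σ)` is the matrix algebra with the adjoint involution of a
symmetric form with Gram matrix `G`, the involution is `X ↦ G⁻¹ Xᵀ G`. Hence `𝒮ym = G⁻¹ · {symmetric
matrices}` has an explicit finite generating family, every linear form on it is `Trd(l ·)` for some
`l` (`OrthogonalSplitting.exists_app_eq_trd`), and an element orthogonal to it is of the form
`a - σ(a)` (`OrthogonalSplitting.exists_eq_sub`). The last fact globalizes to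
`IsOrthogonal.mem_Alt_iff`: `𝒜ℓt` is the orthogonal complement of `𝒮ym`. The reduced trace itself is
glued from local traces; they agree because the trace is invariant under isomorphisms of
matrix algebras (`Matrix.trace_algEquiv`) and glue because the fppf topology is subcanonical.

*Descent.* Let `S` be affine with ring `R`, covered by finitely many flat affine `U_j` with rings
`R_j` over which `𝒜` is split. Then `R_j ⊗ 𝒜(S) → 𝒜(U_j)` is bijective
(`AffineFppfCover.bijective_comparison`): the sheaf condition presents `𝒜(S)` as an equalizer, the
flat base change to `R_j` turns it into the Čech diagram of a covering that has a section, and no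
effectivity of descent data is needed. Since the `R_j` are jointly faithfully flat, a linear
equation with values in an `R`-module that is solvable over every `R_j` is solvable over `R`
(`LinearMap.mem_range_of_forall_flat`). Applied to `(Id + σ)(l) = 1` this yields a global `l` from
`1 ∈ 𝒮ymd(S)`. Applied to the finitely many equations `Trd(l s) = f(s)`, with `s` running through
global generators of `𝒮ym`, it yields the element representing a linear form `f`
(`IsOrthogonal.exists_app_eq_trd`).

*The bijection.* If `f(a + σ(a)) = Trd(a)`, nondegeneracy of the trace form gives `l + σ(l) = 1`,
and `l` is unique modulo `𝒮ym^⊥ = 𝒜ℓt`. Conversely, a section of `𝒜/𝒜ℓt` over `1` is a family of local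
elements `x_V` with `x_V + σ(x_V) = 1` and differences in `𝒜ℓt`; the forms `Trd(x_V ·)` glue to a
quadratic triple (`SymForm.ofFamily`), and an element representing it has the given class.
-/

/-! ### The trace under isomorphisms of matrix algebras -/

namespace Matrix

variable {R : Type*} [CommRing R]

/-- An idempotent matrix `e` that generates a free module and satisfies `e M_m(R) e = R e` has
trace `1`. The hypothesis `h` says that `e E_{kl} e = c_{kl} e` for the matrix units `E_{kl}`. -/
theorem trace_eq_one_of_mul_mul_eq {m : Type*} [Fintype m] (e : Matrix m m R) (c : m → m → R)
    (h : ∀ i k l j, e i k * e l j = c k l * e i j) (he : e * e = e)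
    (hfaithful : ∀ r : R, r • e = 0 → r = 0) : e.trace = 1 := by
  set t := e.trace with ht
  have h1 : ∀ k l, e l k = c k l * t := by
    intro k l
    calc e l k = (e * e) l k := by rw [he]
      _ = ∑ i, e i k * e l i := by
        rw [Matrix.mul_apply]; exact Finset.sum_congr rfl fun i _ => mul_comm _ _
      _ = ∑ i, c k l * e i i := Finset.sum_congr rfl fun i _ => h i k l i
      _ = c k l * t := by rw [← Finset.mul_sum]; rfl
  have h2 : ∀ i k l j, t * (e i k * e l j) = e l k * e i j := by
    intro i k l j
    rw [h, h1 k l]; ring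
  have h3 : t * t = 1 := by
    rw [← sub_eq_zero]
    refine hfaithful _ ?_
    ext i j
    have : ∀ k, (t * t - 1) * (e i k * e k j) = 0 := fun k => by
      rw [sub_mul, mul_assoc, h2, h2]; ring
    calc ((t * t - 1) • e) i j = ((t * t - 1) • (e * e)) i j := by rw [he]
      _ = ∑ k, (t * t - 1) * (e i k * e k j) := by
        rw [Matrix.smul_apply, Matrix.mul_apply, smul_eq_mul, Finset.mul_sum]
      _ = 0 := Finset.sum_eq_zero fun k _ => this k
  have h4 : ∀ i, (1 - t) * (e i i * e i i) = 0 := fun i => by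
    rw [sub_mul, h2]; ring
  -- If `1 - t ≠ 0`, its annihilator lies in a maximal ideal, which then contains every diagonal
  -- entry of `e` and hence the unit `t`.
  by_contra hne
  let I : Ideal R := LinearMap.ker (LinearMap.mulLeft R (1 - t))
  have hI : I ≠ ⊤ := fun htop => hne <| by
    have : (1 : R) ∈ I := htop ▸ Submodule.mem_top
    have : (1 - t) * 1 = 0 := this
    rw [mul_one, sub_eq_zero] at this
    exact this.symm
  obtain ⟨M, hM, hIM⟩ := Ideal.exists_le_maximal I hI
  have hdiag : ∀ i, e i i ∈ M := fun i =>
    (hM.isPrime.mem_or_mem (hIM (show e i i * e i i ∈ I from h4 i))).elim id id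
  have htM : t ∈ M := sum_mem fun i _ => hdiag i
  exact hM.ne_top ((Ideal.eq_top_iff_one _).2 (h3 ▸ M.mul_mem_left t htM))

/-- The trace is invariant under isomorphisms of matrix algebras. No appeal to the theorem of
Skolem and Noether is needed: the off-diagonal matrix units are commutators, and the diagonal ones
go to idempotents of trace `1`. -/
theorem trace_algEquiv {m n : Type*} [Fintype m] [Fintype n] [DecidableEq m]
    [DecidableEq n] (θ : Matrix n n R ≃ₐ[R] Matrix m m R) (x : Matrix n n R) :
    (θ x).trace = x.trace := by
  have hdiag : ∀ p : n, (θ (single p p 1)).trace = 1 := by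
    intro p
    refine trace_eq_one_of_mul_mul_eq _ (fun k l => θ.symm (single k l 1) p p) ?_ ?_ ?_
    · intro i k l j
      have h : θ (single p p 1) * single k l 1 * θ (single p p 1) =
          θ.symm (single k l 1) p p • θ (single p p 1) := by
        have : single k l (1 : R) = θ (θ.symm (single k l 1)) := (θ.apply_symm_apply _).symm
        rw [this, ← map_mul, ← map_mul, ← map_smul, single_mul_mul_single]
        simp [smul_single]
      have h' := congrFun (congrFun h i) j
      rw [Matrix.mul_assoc, Matrix.mul_apply] at h'
      rw [Matrix.smul_apply, smul_eq_mul] at h'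
      rw [← h', Finset.sum_eq_single k]
      · simp [Matrix.mul_apply, Matrix.single_apply]
      · intro b _ hb
        simp [Matrix.mul_apply, hb.symm]
      · simp
    · rw [← map_mul, single_mul_single_same, one_mul]
    · intro r hr
      rw [← map_smul, map_eq_zero_iff θ θ.injective] at hr
      simpa using congrFun (congrFun hr p) p
  have hoff : ∀ p q : n, p ≠ q → (θ (single p q 1)).trace = 0 := by
    intro p q hpq
    have h : single p q (1 : R) = single p p 1 * single p q 1 := by simp
    rw [h, map_mul, Matrix.trace_mul_comm, ← map_mul, single_mul_single_of_ne (h := hpq.symm),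
      map_zero, trace_zero]
  have key : (traceLinearMap m R R) ∘ₗ θ.toLinearMap = traceLinearMap n R R := by
    refine Matrix.ext_linearMap _ fun p q => ?_
    ext
    by_cases hpq : p = q
    · subst hpq
      simp [hdiag]
    · simp [hoff p q hpq, trace_single_eq_of_ne _ _ _ hpq]
  exact LinearMap.congr_fun key x

/-! ### Symmetric and alternating matrices -/

variable {m : Type*} [LinearOrder m]

/-- The standard basis of the symmetric matrices, indexed by pairs: `E_{ii}` for `i = j`,
`E_{ij} + E_{ji}` for `i < j`, and, to keep the index set a product, `0` for `i > j`. -/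
def symmUnit (R : Type*) [CommRing R] (i j : m) : Matrix m m R :=
  if i = j then single i i 1 else if i < j then single i j 1 + single j i 1 else 0

theorem symmUnit_isSymm (i j : m) : (symmUnit R i j).IsSymm := by
  unfold symmUnit IsSymm
  split_ifs <;> simp [transpose_single, add_comm]

theorem symmUnit_map {R' : Type*} [CommRing R'] (ρ : R →+* R') (i j : m) :
    (symmUnit R i j).map ρ = symmUnit R' i j := by
  unfold symmUnit
  split_ifs <;> ext a b <;> simp [Matrix.single_apply, apply_ite ρ]

/-- The coefficient of `symmUnit R i j` may be taken to be `Y i j` for all pairs `i`, `j`, as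
the generators with `i > j` vanish. -/
theorem IsSymm.eq_sum_symmUnit [Fintype m] {Y : Matrix m m R} (hY : Y.IsSymm) :
    Y = ∑ i, ∑ j, Y i j • symmUnit R i j := by
  ext a b
  have key : ∀ i j, (Y i j • symmUnit R i j) a b =
      (if i = a then if j = b then (if i ≤ j then Y i j else 0) else 0 else 0) +
      (if i = b then if j = a then (if i < j then Y i j else 0) else 0 else 0) := by
    intro i j
    unfold symmUnit
    rcases lt_trichotomy i j with h | h | h
    · rw [if_neg h.ne, if_pos h, if_pos h.le, if_pos h]
      simp only [smul_apply, add_apply, single_apply, smul_eq_mul, mul_add, mul_ite, mul_one,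
        mul_zero, ite_and]
      congr 1
      split_ifs <;> rfl
    · subst h
      simp [single_apply, ite_and]
    · rw [if_neg h.ne', if_neg h.not_gt, if_neg h.not_ge, if_neg h.not_gt]
      simp
  simp only [Matrix.sum_apply, key, Finset.sum_add_distrib]
  simp only [Finset.sum_ite_irrel, Finset.sum_ite_eq', Finset.mem_univ, if_true,
    Finset.sum_const_zero]
  rcases lt_trichotomy a b with h | h | h
  · simp [h.le, h.not_gt]
  · simp [h]
  · simp [h.not_ge, h, hY.apply a b]

/-- A matrix that is orthogonal to the symmetric matrices for the trace form is alternating, in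
the form `Y - Yᵀ` that is meaningful also where `2` is not invertible. -/
theorem exists_eq_sub_transpose [Fintype m] {Z : Matrix m m R}
    (hZ : ∀ S : Matrix m m R, S.IsSymm → (Z * S).trace = 0) :
    ∃ Y : Matrix m m R, Z = Y - Y.transpose := by
  have hdiag : ∀ i, Z i i = 0 := fun i => by
    simpa [trace_mul_single] using hZ (single i i 1) (by simp [IsSymm])
  have hoff : ∀ i j, Z i j = - Z j i := fun i j => by
    have := hZ (single i j 1 + single j i 1) (by simp [IsSymm, add_comm])
    rw [Matrix.mul_add, trace_add, trace_mul_single, trace_mul_single, MulOpposite.op_one,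
      one_smul, one_smul] at this
    linear_combination this
  refine ⟨of fun i j => if i < j then Z i j else 0, ?_⟩
  ext i j
  rcases lt_trichotomy i j with h | h | h
  · simp [h, h.not_gt]
  · simp [h, hdiag]
  · simp [h, h.not_gt, hoff i j]

/-- Prescribed values on the standard basis of the symmetric matrices are those of a linear form
`Y ↦ tr(L Y)`. -/
theorem exists_trace_mul_symmUnit_eq [Fintype m] (v : m → m → R)
    (hv : ∀ i j, j < i → v i j = 0) :
    ∃ L : Matrix m m R, ∀ i j, (L * symmUnit R i j).trace = v i j := by
  refine ⟨of fun i j => v j i, fun i j => ?_⟩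
  unfold symmUnit
  rcases lt_trichotomy i j with h | h | h
  · simp [h.ne, h, Matrix.mul_add, trace_mul_single, hv j i h]
  · simp [h, trace_mul_single]
  · simp [h.ne', h.not_gt, hv i j h]

end Matrix

namespace FppfAlg

/-! ### The structure sheaf -/

variable {S : Scheme.{u}}

@[simp]
theorem resO_id {T : Over S} (r : O T) : resO (𝟙 T) r = r := by
  change ((structureSheaf S).map (𝟙 (op T))).hom r = r
  rw [(structureSheaf S).map_id]
  rfl

theorem resO_comp {W V T : Over S} (h : W ⟶ V) (g : V ⟶ T) (r : O T) :
    resO (h ≫ g) r = resO h (resO g r) := by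
  change ((structureSheaf S).map (g.op ≫ h.op)).hom r = _
  rw [(structureSheaf S).map_comp]
  rfl

/-- The structure sheaf is represented by the affine line. -/
noncomputable def structureSheafRepresentableBy (S : Scheme.{u}) :
    (structureSheaf S ⋙ forget CommRingCat.{u}).RepresentableBy
      (Over.mk (𝔸(PUnit.{u + 1}; S) ↘ S)) where
  homEquiv {T} :=
    { toFun f := f.left.appTop.hom (AffineSpace.coord S PUnit.unit)
      invFun v := Over.homMk (AffineSpace.homOfVector T.hom fun _ => v)
        (AffineSpace.homOfVector_over _ _)
      left_inv f := by
        ext : 1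
        refine AffineSpace.hom_ext ?_ fun i => ?_
        · exact (AffineSpace.homOfVector_over _ _).trans (Over.w f).symm
        · exact AffineSpace.homOfVector_appTop_coord _ _ i
      right_inv v := AffineSpace.homOfVector_appTop_coord _ _ PUnit.unit }
  homEquiv_comp {V T} f g := by
    change (f.left ≫ g.left).appTop.hom _ = f.left.appTop.hom (g.left.appTop.hom _)
    rw [Scheme.Hom.comp_appTop]
    rfl

theorem isSheaf_structureSheaf (S : Scheme.{u}) :
    Presieve.IsSheaf (fppf S) (structureSheaf S ⋙ forget CommRingCat.{u}) :=
  haveI := (structureSheafRepresentableBy S).isRepresentable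
  GrothendieckTopology.Subcanonical.isSheaf_of_isRepresentable _

/-- Sections of `𝒪` that agree on a covering sieve are equal. -/
theorem eq_of_locally_eq_O {T : Over S} (R : Sieve T) (hR : R ∈ fppf S T) (a b : O T)
    (h : ∀ ⦃V : Over S⦄ (g : V ⟶ T), R g → resO g a = resO g b) : a = b :=
  (isSheaf_structureSheaf S R hR).isSeparatedFor.ext (fun _ g hg => h g hg)

/-- Compatible sections of `𝒪` on a covering sieve glue. -/
theorem exists_glue_O {T : Over S} (R : Sieve T) (hR : R ∈ fppf S T)
    (c : ∀ ⦃V : Over S⦄ (g : V ⟶ T), R g → O V)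
    (hc : ∀ ⦃W V : Over S⦄ (k : W ⟶ V) (g : V ⟶ T) (hg : R g),
      c (k ≫ g) (R.downward_closed hg k) = resO k (c g hg)) :
    ∃ r : O T, ∀ ⦃V : Over S⦄ (g : V ⟶ T) (hg : R g), resO g r = c g hg := by
  let x : Presieve.FamilyOfElements (structureSheaf S ⋙ forget CommRingCat.{u}) R.arrows := c
  have hx : x.Compatible := by
    rw [Presieve.compatible_iff_sieveCompatible]
    intro V W g k hg
    exact hc k g hg
  obtain ⟨r, hr, -⟩ := isSheaf_structureSheaf S R hR x hx
  exact ⟨r, hr⟩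

/-! ### The reduced trace of a locally split algebra -/

namespace OAlgebra

variable (A : OAlgebra S)

/-- `𝒜` is split, i.e. isomorphic to a matrix algebra over `𝒪`, on the members of some fppf
covering of `S`. -/
def IsLocallySplit : Prop :=
  ∃ R ∈ fppf S (base S), ∀ ⦃T : Over S⦄ (g : T ⟶ base S), R g →
    ∃ n : ℕ, Nonempty (A.Splitting T n)

variable {A}

namespace Splitting

variable {T : Over S} {n : ℕ}

/-- The restriction of a splitting along `V ⟶ T`. -/
def restrict (φ : A.Splitting T n) {V : Over S} (k : V ⟶ T) : A.Splitting V n where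
  iso _ h := φ.iso (h ≫ k)
  natural W V' h g a := by rw [Category.assoc, φ.natural]

theorem trace_eq {m : ℕ} (φ : A.Splitting T n) (ψ : A.Splitting T m) (a : A.Sections T) :
    (φ.iso (𝟙 T) a).trace = (ψ.iso (𝟙 T) a).trace := by
  have := Matrix.trace_algEquiv ((ψ.iso (𝟙 T)).symm.trans (φ.iso (𝟙 T))) (ψ.iso (𝟙 T) a)
  simpa using this

theorem trace_iso_res (φ : A.Splitting T n) {V : Over S} (k : V ⟶ T) (a : A.Sections T) :
    ((φ.restrict k).iso (𝟙 V) (A.res k a)).trace = resO k (φ.iso (𝟙 T) a).trace := by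
  have h := φ.natural k (𝟙 T) a
  change (φ.iso (𝟙 V ≫ k) _).trace = _
  rw [Category.id_comp]
  rw [Category.comp_id] at h
  rw [h, AddMonoidHom.map_trace]

end Splitting

namespace IsLocallySplit

variable (hA : A.IsLocallySplit)
include hA

/-- Sections of `𝒪` that agree wherever `𝒜` is split are equal. -/
theorem ext_O {T : Over S} {c d : O T}
    (h : ∀ ⦃V : Over S⦄ (g : V ⟶ T) (n : ℕ) (_ : A.Splitting V n), resO g c = resO g d) :
    c = d := by
  obtain ⟨R, hR, hs⟩ := hA
  refine eq_of_locally_eq_O (R.pullback (toBase T)) ((fppf S).pullback_stable _ hR) _ _ ?_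
  intro V g hg
  obtain ⟨n, ⟨φ⟩⟩ := hs _ hg
  exact h g n φ

/-- The traces in the local splittings glue, as any two splittings give the same trace. -/
theorem exists_isReducedTrace {T : Over S} (a : A.Sections T) :
    ∃ c : O T, A.IsReducedTrace a c := by
  obtain ⟨R, hR, hs⟩ := id hA
  have hs' : ∀ ⦃V : Over S⦄ (g : V ⟶ T), R.pullback (toBase T) g →
      ∃ n : ℕ, Nonempty (A.Splitting V n) := fun V g hg => hs _ hg
  choose n φ using hs'
  obtain ⟨c, hc⟩ := exists_glue_O (R.pullback (toBase T)) ((fppf S).pullback_stable _ hR)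
    (fun V g hg => ((φ g hg).some.iso (𝟙 V) (A.res g a)).trace) (by
      intro W V k g hg
      rw [← Splitting.trace_iso_res, res_comp]
      exact Splitting.trace_eq _ _ _)
  refine ⟨c, fun V g m ψ => ?_⟩
  refine eq_of_locally_eq_O (R.pullback (g ≫ toBase T)) ((fppf S).pullback_stable _ hR) _ _ ?_
  intro W k hk
  have hk' : R.pullback (toBase T) (k ≫ g) := by
    change R _ at hk ⊢
    rwa [Category.assoc]
  rw [← Splitting.trace_iso_res, ← res_comp, ← resO_comp, hc _ hk']
  exact Splitting.trace_eq _ _ _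

theorem existsUnique_isReducedTrace {T : Over S} (a : A.Sections T) :
    ∃! c : O T, A.IsReducedTrace a c := by
  obtain ⟨c, hc⟩ := hA.exists_isReducedTrace a
  refine ⟨c, hc, fun d hd => hA.ext_O fun V g n φ => ?_⟩
  rw [← hc g n φ, ← hd g n φ]

theorem isReducedTrace_trd {T : Over S} (a : A.Sections T) : A.IsReducedTrace a (A.trd a) := by
  have h := hA.existsUnique_isReducedTrace a
  rw [trd, dif_pos h]
  exact h.choose_spec.1

theorem trd_eq_of_isReducedTrace {T : Over S} {a : A.Sections T} {c : O T}
    (h : A.IsReducedTrace a c) : A.trd a = c :=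
  (hA.existsUnique_isReducedTrace a).unique (hA.isReducedTrace_trd a) h

/-- In a splitting the reduced trace is the trace of matrices. -/
theorem trd_eq_trace {T V : Over S} {n : ℕ} (φ : A.Splitting T n) (h : V ⟶ T)
    (a : A.Sections V) : A.trd a = (φ.iso h a).trace := by
  have := hA.isReducedTrace_trd a (𝟙 V) n (φ.restrict h)
  rw [resO_id, res_id] at this
  rw [← this]
  change (φ.iso (𝟙 V ≫ h) a).trace = _
  rw [Category.id_comp]

theorem trd_res {V T : Over S} (g : V ⟶ T) (a : A.Sections T) :
    A.trd (A.res g a) = resO g (A.trd a) := by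
  refine hA.trd_eq_of_isReducedTrace fun W k n φ => ?_
  rw [← res_comp, ← resO_comp]
  exact hA.isReducedTrace_trd a _ n φ

theorem trd_add {T : Over S} (a b : A.Sections T) : A.trd (a + b) = A.trd a + A.trd b :=
  hA.trd_eq_of_isReducedTrace fun V g n φ => by
    rw [map_add, map_add, Matrix.trace_add, map_add, hA.isReducedTrace_trd a g n φ,
      hA.isReducedTrace_trd b g n φ]

theorem trd_smul {T : Over S} (r : O T) (a : A.Sections T) : A.trd (r • a) = r * A.trd a :=
  hA.trd_eq_of_isReducedTrace fun V g n φ => by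
    rw [res_smul, map_smul, Matrix.trace_smul, hA.isReducedTrace_trd a g n φ, map_mul, smul_eq_mul]

theorem trd_mul_comm {T : Over S} (a b : A.Sections T) : A.trd (a * b) = A.trd (b * a) :=
  hA.trd_eq_of_isReducedTrace fun V g n φ => by
    rw [← hA.isReducedTrace_trd (b * a) g n φ, map_mul, map_mul, Matrix.trace_mul_comm, map_mul,
      map_mul]

/-- The reduced trace as a linear form on `𝒜(T)`. -/
noncomputable def trdLinear (T : Over S) : A.Sections T →ₗ[O T] O T where
  toFun := A.trd
  map_add' := hA.trd_add
  map_smul' := hA.trd_smul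

theorem trd_sub {T : Over S} (a b : A.Sections T) : A.trd (a - b) = A.trd a - A.trd b :=
  map_sub (hA.trdLinear T) a b

end IsLocallySplit

end OAlgebra

end FppfAlg

/-! ### Orthogonal involutions in coordinates -/

namespace FppfAlg
namespace OAlgebra
variable {S : Scheme.{u}} {A : OAlgebra S}

theorem Splitting.iso_res {T : Over S} {n : ℕ} (φ : A.Splitting T n) {V : Over S} (h : V ⟶ T)
    (a : A.Sections T) : φ.iso h (A.res h a) = (φ.iso (𝟙 T) a).map (resO h) := by
  have := φ.natural h (𝟙 T) a
  rwa [Category.comp_id] at this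

namespace Involution

variable (σ : A.Involution)

/-- A splitting of `𝒜` over `T` that identifies `σ` with the adjoint involution of the symmetric
bilinear form with Gram matrix `G`; the inverse of `G` is part of the data. -/
structure OrthogonalSplitting (T : Over S) (n : ℕ) where
  φ : A.Splitting T n
  G : Matrix (Fin n) (Fin n) (O T)
  H : Matrix (Fin n) (Fin n) (O T)
  isSymm : G.IsSymm
  G_mul_H : G * H = 1
  H_mul_G : H * G = 1
  adjoint : ∀ ⦃V : Over S⦄ (h : V ⟶ T) (a : A.Sections V),
    (φ.iso h (σ.app V a)).transpose * G.map (resO h) = G.map (resO h) * φ.iso h a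

variable {σ}

theorem IsOrthogonal.exists_splitting (hσ : σ.IsOrthogonal) :
    ∃ R ∈ fppf S (base S), ∀ ⦃T : Over S⦄ (g : T ⟶ base S), R g →
      ∃ n : ℕ, Nonempty (σ.OrthogonalSplitting T n) := by
  obtain ⟨R, hR, h⟩ := hσ
  refine ⟨R, hR, fun T g hg => ?_⟩
  obtain ⟨n, φ, G, hG, hu, had⟩ := h g hg
  obtain ⟨H, hGH, hHG⟩ := isUnit_iff_exists.1 hu
  exact ⟨n, ⟨⟨φ, G, H, hG, hGH, hHG, had⟩⟩⟩

theorem IsOrthogonal.isLocallySplit (hσ : σ.IsOrthogonal) : A.IsLocallySplit := by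
  obtain ⟨R, hR, h⟩ := hσ.exists_splitting
  exact ⟨R, hR, fun T g hg => (h g hg).imp fun n ⟨ψ⟩ => ⟨ψ.φ⟩⟩

namespace OrthogonalSplitting

variable {T : Over S} {n : ℕ} (ψ : σ.OrthogonalSplitting T n)

theorem map_G_mul_map_H {V : Over S} (h : V ⟶ T) :
    ψ.G.map (resO h) * ψ.H.map (resO h) = 1 := by
  rw [← Matrix.map_mul, ψ.G_mul_H, Matrix.map_one _ (map_zero _) (map_one _)]

theorem map_H_mul_map_G {V : Over S} (h : V ⟶ T) :
    ψ.H.map (resO h) * ψ.G.map (resO h) = 1 := by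
  rw [← Matrix.map_mul, ψ.H_mul_G, Matrix.map_one _ (map_zero _) (map_one _)]

theorem map_G_transpose {V : Over S} (h : V ⟶ T) :
    (ψ.G.map (resO h)).transpose = ψ.G.map (resO h) := by
  rw [← Matrix.transpose_map, ψ.isSymm.eq]

/-- In coordinates, `σ` is `X ↦ G⁻¹ Xᵀ G`. -/
theorem iso_app {V : Over S} (h : V ⟶ T) (a : A.Sections V) :
    ψ.φ.iso h (σ.app V a) =
      ψ.H.map (resO h) * ((ψ.φ.iso h a).transpose * ψ.G.map (resO h)) := by
  have h1 := congrArg Matrix.transpose (ψ.adjoint h a)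
  rw [Matrix.transpose_mul, Matrix.transpose_mul, Matrix.transpose_transpose,
    ψ.map_G_transpose] at h1
  rw [← h1, ← Matrix.mul_assoc, ψ.map_H_mul_map_G, Matrix.one_mul]

theorem mem_Sym_iff {V : Over S} (h : V ⟶ T) (a : A.Sections V) :
    a ∈ σ.Sym V ↔ (ψ.G.map (resO h) * ψ.φ.iso h a).IsSymm := by
  rw [mem_Sym, ← (ψ.φ.iso h).injective.eq_iff, ψ.iso_app, Matrix.IsSymm, Matrix.transpose_mul,
    ψ.map_G_transpose]
  constructor
  · intro h1
    rw [← h1, ← Matrix.mul_assoc (ψ.G.map _), ψ.map_G_mul_map_H, Matrix.one_mul, h1]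
  · intro h1
    rw [h1, ← Matrix.mul_assoc, ψ.map_H_mul_map_G, Matrix.one_mul]

/-- The symmetric element with coordinate matrix `G⁻¹ Y`, for a symmetric matrix `Y`. -/
noncomputable def ofSymm (Y : Matrix (Fin n) (Fin n) (O T)) (hY : Y.IsSymm) : σ.Sym T :=
  ⟨(ψ.φ.iso (𝟙 T)).symm (ψ.H * Y), by
    have hG : ψ.G.map (resO (𝟙 T)) = ψ.G := by ext; simp
    rw [ψ.mem_Sym_iff (𝟙 T), AlgEquiv.apply_symm_apply, hG, ← Matrix.mul_assoc, ψ.G_mul_H,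
      Matrix.one_mul]
    exact hY⟩

theorem iso_ofSymm (Y : Matrix (Fin n) (Fin n) (O T)) (hY : Y.IsSymm) :
    ψ.φ.iso (𝟙 T) (ψ.ofSymm Y hY : A.Sections T) = ψ.H * Y :=
  AlgEquiv.apply_symm_apply _ _

/-- The generators of `𝒮ym` over `T` given by the standard basis of the symmetric matrices. -/
noncomputable def gen (i j : Fin n) : σ.Sym T :=
  ψ.ofSymm (Matrix.symmUnit (O T) i j) (Matrix.symmUnit_isSymm i j)

/-- The generators over `T` still generate over every `V ⟶ T`. -/
theorem mem_span_gen {V : Over S} (h : V ⟶ T) {t : A.Sections V} (ht : t ∈ σ.Sym V) :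
    t ∈ Submodule.span (O V)
      (Set.range fun p : Fin n × Fin n => A.res h (ψ.gen p.1 p.2 : A.Sections T)) := by
  have hgen : ∀ i j, ψ.φ.iso h (A.res h (ψ.gen i j : A.Sections T)) =
      ψ.H.map (resO h) * Matrix.symmUnit (O V) i j := by
    intro i j
    rw [ψ.φ.iso_res, gen, iso_ofSymm, Matrix.map_mul, Matrix.symmUnit_map]
  have key : t = ∑ p : Fin n × Fin n, (ψ.G.map (resO h) * ψ.φ.iso h t) p.1 p.2 •
      A.res h (ψ.gen p.1 p.2 : A.Sections T) := by
    refine (ψ.φ.iso h).injective ?_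
    simp only [map_sum, map_smul, hgen, ← Matrix.mul_smul, ← Finset.mul_sum]
    rw [Fintype.sum_prod_type, ← ((ψ.mem_Sym_iff h t).1 ht).eq_sum_symmUnit, ← Matrix.mul_assoc,
      ψ.map_H_mul_map_G, Matrix.one_mul]
  rw [key]
  exact sum_mem fun p _ => Submodule.smul_mem _ _ (Submodule.subset_span ⟨p, rfl⟩)

theorem trd_app (ψ : σ.OrthogonalSplitting T n) (hA : A.IsLocallySplit) {V : Over S} (h : V ⟶ T)
    (a : A.Sections V) : A.trd (σ.app V a) = A.trd a := by
  rw [hA.trd_eq_trace ψ.φ h, hA.trd_eq_trace ψ.φ h, ψ.iso_app, Matrix.trace_mul_comm,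
    Matrix.mul_assoc, ψ.map_G_mul_map_H, Matrix.mul_one, Matrix.trace_transpose]

/-- Locally the orthogonal complement of `𝒮ym` for the trace form is the image of `Id - σ`. -/
theorem exists_eq_sub (ψ : σ.OrthogonalSplitting T n) (hA : A.IsLocallySplit) {x : A.Sections T}
    (hx : ∀ t : σ.Sym T, A.trd (x * (t : A.Sections T)) = 0) : ∃ a, σ.idSub.app T a = x := by
  obtain ⟨Y, hY⟩ := Matrix.exists_eq_sub_transpose (Z := ψ.φ.iso (𝟙 T) x * ψ.H) fun M hM => by
    rw [← hx (ψ.ofSymm M hM), hA.trd_eq_trace ψ.φ (𝟙 T), _root_.map_mul, iso_ofSymm,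
      Matrix.mul_assoc]
  have hG : ψ.G.map (resO (𝟙 T)) = ψ.G := by ext; simp
  have hH : ψ.H.map (resO (𝟙 T)) = ψ.H := by ext; simp
  refine ⟨(ψ.φ.iso (𝟙 T)).symm (Y * ψ.G), (ψ.φ.iso (𝟙 T)).injective ?_⟩
  set y := (ψ.φ.iso (𝟙 T)).symm (Y * ψ.G) with hy
  change ψ.φ.iso (𝟙 T) (y - σ.app T y) = _
  rw [map_sub, ψ.iso_app, hy, AlgEquiv.apply_symm_apply, hG, hH, Matrix.transpose_mul, ψ.isSymm.eq,
    ← Matrix.mul_assoc, ← Matrix.mul_assoc, ψ.H_mul_G, Matrix.one_mul, ← Matrix.sub_mul, ← hY,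
    Matrix.mul_assoc, ψ.H_mul_G, Matrix.mul_one]

end OrthogonalSplitting

theorem SymForm.app_zero (f : σ.SymForm) {T : Over S} (s : σ.Sym T) (hs : (s : A.Sections T) = 0) :
    f.app T s = 0 := by
  rw [show s = 0 from Subtype.ext hs, map_zero]

/-- To compare a linear form over `V` with `Trd(l ·)` it suffices to evaluate on generators that
are defined over some `T`. -/
theorem SymForm.app_eq_trd_of_mem_span (hA : A.IsLocallySplit) (f : σ.SymForm) {V T : Over S}
    (h : V ⟶ T) (l : A.Sections T) {ι : Type*} (s : ι → σ.Sym T)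
    (hs : ∀ i, f.app T (s i) = A.trd (l * (s i : A.Sections T))) (t : σ.Sym V)
    (ht : (t : A.Sections V) ∈ Submodule.span (O V)
      (Set.range fun i => A.res h (s i : A.Sections T))) :
    f.app V t = A.trd (A.res h l * (t : A.Sections V)) := by
  let d : σ.Sym V →ₗ[O V] O V :=
    f.app V - hA.trdLinear V ∘ₗ LinearMap.mulLeft (O V) (A.res h l) ∘ₗ (σ.Sym V).subtype
  have hle : Submodule.span (O V) (Set.range fun i => A.res h (s i : A.Sections T)) ≤
      (LinearMap.ker d).map (σ.Sym V).subtype := by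
    rw [Submodule.span_le]
    rintro _ ⟨i, rfl⟩
    refine ⟨⟨A.res h (s i), σ.res_mem_Sym h (s i).2⟩, ?_, rfl⟩
    change f.app V _ - A.trd (A.res h l * A.res h (s i : A.Sections T)) = 0
    rw [f.natural, hs, ← _root_.map_mul, hA.trd_res, sub_self]
  obtain ⟨t', ht', htt⟩ := hle ht
  obtain rfl : t' = t := Subtype.ext htt
  exact sub_eq_zero.1 ht'

/-- Over an orthogonal splitting every linear form on `𝒮ym` is of the form `Trd(l ·)`. -/
theorem OrthogonalSplitting.exists_app_eq_trd {T : Over S} {n : ℕ}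
    (ψ : σ.OrthogonalSplitting T n) (hA : A.IsLocallySplit) (f : σ.SymForm) :
    ∃ l : A.Sections T, ∀ ⦃V : Over S⦄ (h : V ⟶ T) (t : σ.Sym V),
      f.app V t = A.trd (A.res h l * (t : A.Sections V)) := by
  obtain ⟨L, hL⟩ := Matrix.exists_trace_mul_symmUnit_eq (fun i j => f.app T (ψ.gen i j))
    fun i j hij => f.app_zero _ ((ψ.φ.iso (𝟙 T)).injective (by
      rw [gen, iso_ofSymm, map_zero]
      simp [Matrix.symmUnit, hij.ne', hij.not_gt]))
  refine ⟨(ψ.φ.iso (𝟙 T)).symm (L * ψ.G), fun V h t => ?_⟩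
  refine f.app_eq_trd_of_mem_span hA h _ (fun p : Fin n × Fin n => ψ.gen p.1 p.2) ?_ t
    (ψ.mem_span_gen h t.2)
  intro p
  rw [← hL, hA.trd_eq_trace ψ.φ (𝟙 T), _root_.map_mul, AlgEquiv.apply_symm_apply, gen, iso_ofSymm,
    Matrix.mul_assoc, ← Matrix.mul_assoc ψ.G, ψ.G_mul_H, Matrix.one_mul]

end Involution

/-- The reduced trace form is nondegenerate. -/
theorem IsLocallySplit.eq_zero_of_trd_mul_eq_zero (hA : A.IsLocallySplit) {T : Over S}
    (x : A.Sections T)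
    (hx : ∀ ⦃V : Over S⦄ (g : V ⟶ T) (a : A.Sections V), A.trd (A.res g x * a) = 0) : x = 0 := by
  obtain ⟨R, hR, hs⟩ := id hA
  refine A.eq_of_locally_eq (R.pullback (toBase T)) ((fppf S).pullback_stable _ hR) _ _ ?_
  intro V g hg
  obtain ⟨n, ⟨φ⟩⟩ := hs _ hg
  refine (φ.iso (𝟙 V)).injective (Matrix.ext_iff_trace_mul_right.2 fun M => ?_)
  have := hx g ((φ.iso (𝟙 V)).symm M)
  rw [hA.trd_eq_trace φ (𝟙 V), _root_.map_mul, AlgEquiv.apply_symm_apply] at this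
  rw [this]
  simp

namespace Involution
variable {σ : A.Involution}

namespace IsOrthogonal

variable (hσ : σ.IsOrthogonal)
include hσ

theorem trd_app {T : Over S} (a : A.Sections T) : A.trd (σ.app T a) = A.trd a := by
  obtain ⟨R, hR, hs⟩ := hσ.exists_splitting
  refine eq_of_locally_eq_O (R.pullback (toBase T)) ((fppf S).pullback_stable _ hR) _ _ ?_
  intro V g hg
  obtain ⟨n, ⟨ψ⟩⟩ := hs _ hg
  rw [← hσ.isLocallySplit.trd_res, ← hσ.isLocallySplit.trd_res, ← σ.natural,
    ψ.trd_app hσ.isLocallySplit (𝟙 V)]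

/-- `Trd(a s) = Trd(σ(a s)) = Trd(s σ(a)) = Trd(σ(a) s)` for symmetric `s`. -/
theorem trd_idSub_mul {T : Over S} (a : A.Sections T) {t : A.Sections T} (ht : t ∈ σ.Sym T) :
    A.trd (σ.idSub.app T a * t) = 0 := by
  have hA := hσ.isLocallySplit
  rw [mem_Sym] at ht
  change A.trd ((a - σ.app T a) * t) = 0
  have h : σ.app T a * t = σ.app T (t * a) := by rw [σ.map_mul, ht]
  rw [sub_mul, hA.trd_sub, h, hσ.trd_app, hA.trd_mul_comm, sub_self]

/-- `𝒜ℓt` is the orthogonal complement of `𝒮ym` for the reduced trace form. -/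
theorem mem_Alt_iff {T : Over S} (x : A.Sections T) :
    x ∈ σ.Alt T ↔ ∀ ⦃V : Over S⦄ (g : V ⟶ T), ∀ t ∈ σ.Sym V, A.trd (A.res g x * t) = 0 := by
  have hA := hσ.isLocallySplit
  constructor
  · intro hx V g t ht
    obtain ⟨R, hR, h⟩ := σ.idSub.res_mem_image g hx
    refine eq_of_locally_eq_O R hR _ _ fun W k hk => ?_
    obtain ⟨a, ha⟩ := h k hk
    rw [← hA.trd_res, _root_.map_mul, ← ha, hσ.trd_idSub_mul a (σ.res_mem_Sym k ht), map_zero]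
  · intro hx
    obtain ⟨R, hR, hs⟩ := hσ.exists_splitting
    refine ⟨R.pullback (toBase T), (fppf S).pullback_stable _ hR, fun V g hg => ?_⟩
    obtain ⟨n, ⟨ψ⟩⟩ := hs _ hg
    exact ψ.exists_eq_sub hA fun t => hx g t t.2

end IsOrthogonal

end Involution
end OAlgebra
end FppfAlg

/-! ### Affine fppf coverings -/

namespace FppfAlg

variable {S : Scheme.{u}}

/-- A finite fppf covering of `S` by affine schemes. Being fppf is recorded by the covering sieve;
flatness and joint surjectivity are kept for their use on rings of functions. -/
structure AffineFppfCover (S : Scheme.{u}) where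
  ι : Type u
  finite : Finite ι
  U : ι → Over S
  map : ∀ i, U i ⟶ OAlgebra.base S
  isAffine : ∀ i, IsAffine (U i).left
  flat : ∀ i, Flat (U i).hom
  jointlySurjective : ∀ x : S, ∃ i, x ∈ Set.range (U i).hom
  covering : Sieve.ofArrows U map ∈ fppf S (OAlgebra.base S)

/-- Every fppf covering sieve of an affine scheme contains a finite covering by affine schemes. -/
theorem exists_affineFppfCover [IsAffine S] (R : Sieve (OAlgebra.base S))
    (hR : R ∈ fppf S (OAlgebra.base S)) :
    ∃ 𝒰 : AffineFppfCover S, ∀ i, R (𝒰.map i) := by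
  rw [GrothendieckTopology.mem_over_iff] at hR
  have : (Scheme.fppfPrecoverage.{u}).HasIsos :=
    ⟨fun f _ => Scheme.Hom.singleton_mem_fppfPrecoverage f⟩
  rw [Precoverage.mem_toGrothendieck_iff_of_isStableUnderComposition] at hR
  obtain ⟨P, hP, hPR⟩ := hR
  obtain ⟨𝒱, rfl⟩ := Precoverage.mem_iff_exists_zeroHypercover.1 hP
  let 𝒱' : (OAlgebra.base S).left.Cover
      (Scheme.precoverage (@Flat ⊓ @LocallyOfFinitePresentation)) := 𝒱
  have : CompactSpace (OAlgebra.base S).left := inferInstanceAs (CompactSpace S)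
  -- fppf morphisms are open, so that the quasi-compact scheme `S` is covered by finitely many of
  -- the images of affine opens
  have hqc : QuasiCompactCover 𝒱'.ulift.toPreZeroHypercover :=
    QuasiCompactCover.of_isOpenMap fun i => by
      obtain ⟨h1, h2⟩ := 𝒱'.ulift.map_prop i
      exact (𝒱'.ulift.f i).isOpenMap
  have : (@Flat ⊓ @LocallyOfFinitePresentation : MorphismProperty Scheme.{u}).RespectsLeft
      @IsOpenImmersion := ⟨fun i hi f ⟨hf, hf'⟩ => ⟨inferInstance, inferInstance⟩⟩
  obtain ⟨𝒲, f, hfin, -⟩ := QuasiCompactCover.exists_hom 𝒱'.ulift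
  refine ⟨{
    ι := 𝒲.I₀
    finite := hfin
    U := fun i => Over.mk (𝒲.f i)
    map := fun i => Over.homMk (𝒲.f i)
    isAffine := fun i => inferInstanceAs (IsAffine (Spec _))
    flat := fun i => (𝒲.map_prop i).1
    jointlySurjective := fun x => ⟨_, 𝒲.covers x⟩
    covering := ?_ }, ?_⟩
  · rw [GrothendieckTopology.mem_over_iff, Sieve.overEquiv_ofArrows]
    exact Precoverage.generate_mem_toGrothendieck 𝒲.cover.mem₀
  · intro i
    have h1 := hPR _ _ (Presieve.ofArrows.mk (𝒱'.idx (f.s₀ i)))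
    rw [Sieve.overEquiv_iff] at h1
    have hw : f.h₀ i ≫ 𝒱'.f (𝒱'.idx (f.s₀ i)) = 𝒲.f i := f.w₀ i
    let k : (Over.mk (𝒲.f i) : Over S) ⟶
        Over.mk (𝒱'.f (𝒱'.idx (f.s₀ i)) ≫ (OAlgebra.base S).hom) :=
      Over.homMk (f.h₀ i) (by
        exact (congrArg (f.h₀ i ≫ ·) (Category.comp_id _)).trans hw)
    have h2 := R.downward_closed h1 k
    convert h2 using 1
    ext : 1
    exact hw.symm

end FppfAlg

/-! ### Flat descent of modules -/

section FlatDescent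

open TensorProduct

/-- If a jointly surjective family of flat ring maps `R → R_j` makes `y` a value of `h` after base
change to every `R_j`, then `y` is already a value of `h`. -/
theorem LinearMap.mem_range_of_forall_flat {R : Type*} [CommRing R] {ι : Type*} (B : ι → Type*)
    [∀ j, CommRing (B j)] [∀ j, Algebra R (B j)] [∀ j, Module.Flat R (B j)]
    (hB : ∀ 𝔭 : PrimeSpectrum R, ∃ j, 𝔭 ∈ Set.range (PrimeSpectrum.comap (algebraMap R (B j))))
    {M N : Type*} [AddCommGroup M] [AddCommGroup N] [Module R M] [Module R N] (h : M →ₗ[R] N)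
    (y : N) (hy : ∀ j, (1 : B j) ⊗ₜ[R] y ∈ LinearMap.range (h.lTensor (B j))) :
    y ∈ LinearMap.range h := by
  let I : Ideal R := (LinearMap.range h).comap (LinearMap.toSpanSingleton R N y)
  suffices hI : I = ⊤ by
    have : (1 : R) ∈ I := hI ▸ Submodule.mem_top
    simpa [I] using this
  by_contra hI
  obtain ⟨𝔪, h𝔪, hle⟩ := Ideal.exists_le_maximal I hI
  obtain ⟨j, ⟨q, hq⟩⟩ := hB ⟨𝔪, h𝔪.isPrime⟩
  -- `R / I` embeds into the cokernel of `h` by `1 ↦ y`, and this persists after the flat base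
  -- change to `B j`.
  let C := N ⧸ LinearMap.range h
  let e : R →ₗ[R] C := (LinearMap.range h).mkQ ∘ₗ LinearMap.toSpanSingleton R N y
  have hex : Function.Exact I.subtype e := by
    rw [LinearMap.exact_iff]
    ext r
    have : e r = 0 ↔ r • y ∈ LinearMap.range h := by
      change (LinearMap.range h).mkQ (r • y) = 0 ↔ _
      rw [Submodule.mkQ_apply, Submodule.Quotient.mk_eq_zero]
    rw [LinearMap.mem_ker, this]
    simp [I]
  have hexB := Module.Flat.lTensor_exact (B j) hex
  have h0 : e.lTensor (B j) (1 ⊗ₜ 1) = 0 := by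
    obtain ⟨z, hz⟩ := hy j
    have h1 : e.lTensor (B j) (1 ⊗ₜ 1) = (LinearMap.range h).mkQ.lTensor (B j) (1 ⊗ₜ y) := by
      rw [LinearMap.lTensor_tmul, LinearMap.lTensor_tmul, LinearMap.comp_apply,
        LinearMap.toSpanSingleton_apply, one_smul]
    rw [h1, ← hz, ← LinearMap.comp_apply, ← LinearMap.lTensor_comp, LinearMap.range_mkQ_comp]
    simp
  obtain ⟨w, hw⟩ := (hexB _).1 h0
  have hmem : ∀ w : B j ⊗[R] I, (TensorProduct.rid R (B j)) (I.subtype.lTensor (B j) w) ∈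
      q.asIdeal := by
    intro w
    induction w with
    | zero => simp
    | add a b ha hb => rw [map_add, map_add]; exact add_mem ha hb
    | tmul b r =>
      have hr : algebraMap R (B j) r ∈ q.asIdeal := by
        have : (r : R) ∈ (PrimeSpectrum.comap (algebraMap R (B j)) q).asIdeal := by
          rw [hq]; exact hle r.2
        exact this
      simp only [LinearMap.lTensor_tmul, Submodule.subtype_apply, TensorProduct.rid_tmul]
      rw [Algebra.smul_def]
      exact q.asIdeal.mul_mem_right _ hr
  have h1 := hmem w
  rw [hw, TensorProduct.rid_tmul, one_smul] at h1
  exact q.isPrime.ne_top ((Ideal.eq_top_iff_one _).2 h1)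

theorem TensorProduct.lTensor_proj_eq_piRight {R B ι : Type*} [CommRing R] [AddCommGroup B]
    [Module R B] [Fintype ι] [DecidableEq ι] {X : ι → Type*} [∀ i, AddCommGroup (X i)]
    [∀ i, Module R (X i)] (x : B ⊗[R] ∀ i, X i) (i : ι) :
    (LinearMap.proj (R := R) (φ := X) i).lTensor B x = TensorProduct.piRight R R B X x i := by
  induction x with
  | zero => simp
  | add x y hx hy => rw [map_add, map_add, hx, hy]; rfl
  | tmul b x => simp

/-- Base change along a member of a flat covering, from Čech data. Here `M` is the equalizer of
`∏ M_i ⇉ ∏ M_{ik}`, and `e i`, `e₂ i k` are the comparison maps to the sections over the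
fibre products with the `j`-th member `B` of the covering; `β` and `β₂` are the other projections
into these fibre products, `γ₁` and `γ₂` the restrictions from twofold to threefold products, and
`δ` is the restriction along the diagonal of the `j`-th member. Flatness makes `B ⊗ M` the equalizer
of the base-changed diagram, which is the Čech diagram of a covering with a section. -/
theorem bijective_of_cech {R B : Type*} [CommRing R] [CommRing B] [Algebra R B] [Module.Flat R B]
    {ι : Type*} [Finite ι] (j : ι)
    {M : Type*} [AddCommGroup M] [Module R M]
    {N : ι → Type*} [∀ i, AddCommGroup (N i)] [∀ i, Module R (N i)]
    {N₂ : ι → ι → Type*} [∀ i k, AddCommGroup (N₂ i k)] [∀ i k, Module R (N₂ i k)]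
    {P : ι → Type*} [∀ i, AddCommGroup (P i)]
    {P₂ : ι → ι → Type*} [∀ i k, AddCommGroup (P₂ i k)]
    (ρ : ∀ i, M →ₗ[R] N i) (α₁ : ∀ i k, N i →ₗ[R] N₂ i k) (α₂ : ∀ i k, N k →ₗ[R] N₂ i k)
    (hinj : ∀ m, (∀ i, ρ i m = 0) → m = 0)
    (hker : ∀ n : ∀ i, N i, (∀ i k, α₁ i k (n i) = α₂ i k (n k)) ↔ ∃ m, ∀ i, ρ i m = n i)
    (c : B ⊗[R] M →+ N j) (e : ∀ i, B ⊗[R] N i →+ P i) (e₂ : ∀ i k, B ⊗[R] N₂ i k →+ P₂ i k)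
    (he : ∀ i, Function.Bijective (e i)) (he₂ : ∀ i k, Function.Injective (e₂ i k))
    (β : ∀ i, N j →+ P i) (hβ : ∀ i x, e i ((ρ i).lTensor B x) = β i (c x))
    (γ₁ : ∀ i k, P i →+ P₂ i k) (γ₂ : ∀ i k, P k →+ P₂ i k)
    (hγ₁ : ∀ i k x, e₂ i k ((α₁ i k).lTensor B x) = γ₁ i k (e i x))
    (hγ₂ : ∀ i k x, e₂ i k ((α₂ i k).lTensor B x) = γ₂ i k (e k x))
    (hγ : ∀ i k x, γ₁ i k (β i x) = γ₂ i k (β k x))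
    (δ : P j →+ N j) (hδ : ∀ x, δ (β j x) = x) :
    Function.Bijective c := by
  classical
  have := Fintype.ofFinite ι
  let ρ' : M →ₗ[R] ∀ i, N i := LinearMap.pi ρ
  let d : (∀ i, N i) →ₗ[R] ∀ p : ι × ι, N₂ p.1 p.2 := LinearMap.pi fun p =>
    α₁ p.1 p.2 ∘ₗ LinearMap.proj p.1 - α₂ p.1 p.2 ∘ₗ LinearMap.proj p.2
  have hex : Function.Exact ρ' d := by
    intro n
    have : (d n = 0) ↔ ∀ i k, α₁ i k (n i) = α₂ i k (n k) := by
      simp [funext_iff, d, sub_eq_zero]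
    rw [this, hker]
    simp [ρ', funext_iff]
  have hρ' : Function.Injective ρ' := (injective_iff_map_eq_zero _).2 fun m hm =>
    hinj m fun i => congrFun hm i
  have hexB := Module.Flat.lTensor_exact B hex
  have hρB := Module.Flat.lTensor_preserves_injective_linearMap (M := B) ρ' hρ'
  have hcomp : ∀ i x, (LinearMap.proj i).lTensor B (ρ'.lTensor B x) = (ρ i).lTensor B x := by
    intro i x
    rw [← LinearMap.comp_apply, ← LinearMap.lTensor_comp]
    rfl
  constructor
  · rw [injective_iff_map_eq_zero]
    intro x hx
    refine (injective_iff_map_eq_zero _).1 hρB x ?_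
    refine (TensorProduct.piRight R R B N).injective ?_
    ext i
    rw [← TensorProduct.lTensor_proj_eq_piRight, hcomp, map_zero, Pi.zero_apply]
    refine (injective_iff_map_eq_zero _).1 (he i).1 _ ?_
    rw [hβ, hx, map_zero]
  · intro a
    -- the pullbacks of `a` to the fibre products come from `B ⊗ N i` and agree on overlaps
    choose y hy using fun i => (he i).2 (β i a)
    obtain ⟨z, hz⟩ := (TensorProduct.piRight R R B N).surjective y
    have hzi : ∀ i, (LinearMap.proj i).lTensor B z = y i := fun i => by
      rw [TensorProduct.lTensor_proj_eq_piRight, hz]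
    have hdz : d.lTensor B z = 0 := by
      refine (TensorProduct.piRight R R B fun p : ι × ι => N₂ p.1 p.2).injective ?_
      ext ⟨i, k⟩
      have hd : LinearMap.proj (i, k) ∘ₗ d =
          α₁ i k ∘ₗ LinearMap.proj i - α₂ i k ∘ₗ LinearMap.proj k := rfl
      rw [← TensorProduct.lTensor_proj_eq_piRight, map_zero, Pi.zero_apply,
        ← LinearMap.comp_apply, ← LinearMap.lTensor_comp, hd, LinearMap.lTensor_sub,
        LinearMap.sub_apply, LinearMap.lTensor_comp, LinearMap.lTensor_comp, LinearMap.comp_apply,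
        LinearMap.comp_apply, hzi, hzi]
      refine (injective_iff_map_eq_zero _).1 (he₂ i k) _ ?_
      rw [map_sub, hγ₁, hγ₂, hy, hy, hγ, sub_self]
    obtain ⟨x, hx⟩ := (hexB _).1 hdz
    refine ⟨x, ?_⟩
    rw [← hδ (c x), ← hβ, ← hcomp, hx, hzi, hy, hδ]

end FlatDescent

namespace FppfAlg

open TensorProduct

variable {S : Scheme.{u}}

/-! ### Sections as modules over the ring of the base -/

/-- The sections of `𝒪` as algebras over the ring of `S`. The latter is written `Γ(S, ⊤)` and not
`O (base S)`, so that this structure does not compete with the tautological one over `base S`. -/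
instance algebraBase (T : Over S) : Algebra Γ(S, ⊤) (O T) := (T.hom.appTop.hom).toAlgebra

theorem resO_algebraMap {V T : Over S} (g : V ⟶ T) (r : Γ(S, ⊤)) :
    resO g (algebraMap Γ(S, ⊤) (O T) r) = algebraMap Γ(S, ⊤) (O V) r := by
  change g.left.appTop.hom (T.hom.appTop.hom r) = V.hom.appTop.hom r
  rw [← Over.w g, Scheme.Hom.comp_appTop]
  rfl

theorem resO_smul {V T : Over S} (g : V ⟶ T) (r : Γ(S, ⊤)) (b : O T) :
    resO g (r • b) = r • resO g b := by
  rw [Algebra.smul_def, Algebra.smul_def, map_mul, resO_algebraMap]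

/-- The fibre product over `S`, as an object of the category of `S`-schemes. -/
noncomputable def prod (X Y : Over S) : Over S :=
  Over.mk (Limits.pullback.fst X.hom Y.hom ≫ X.hom)

namespace prod

variable (X Y : Over S)

/-- The projection of the fibre product to the first factor. -/
noncomputable def fst : prod X Y ⟶ X := Over.homMk (Limits.pullback.fst X.hom Y.hom)

/-- The projection of the fibre product to the second factor. -/
noncomputable def snd : prod X Y ⟶ Y :=
  Over.homMk (Limits.pullback.snd X.hom Y.hom) Limits.pullback.condition.symm

variable {X Y}

/-- The morphism to the fibre product given by its two components. -/
noncomputable def lift {Z : Over S} (f : Z ⟶ X) (g : Z ⟶ Y) : Z ⟶ prod X Y :=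
  Over.homMk (Limits.pullback.lift f.left g.left ((Over.w f).trans (Over.w g).symm))
    ((Limits.pullback.lift_fst_assoc _ _ _ _).trans (Over.w f))

theorem lift_fst {Z : Over S} (f : Z ⟶ X) (g : Z ⟶ Y) : lift f g ≫ fst X Y = f := by
  ext : 1
  exact Limits.pullback.lift_fst _ _ _

theorem lift_snd {Z : Over S} (f : Z ⟶ X) (g : Z ⟶ Y) : lift f g ≫ snd X Y = g := by
  ext : 1
  exact Limits.pullback.lift_snd _ _ _

variable (X Y)

theorem isAffine [IsAffine S] (hX : IsAffine X.left) (hY : IsAffine Y.left) :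
    IsAffine (prod X Y).left :=
  inferInstanceAs (IsAffine (Limits.pullback X.hom Y.hom))

theorem isPushout [IsAffine S] (hX : IsAffine X.left) (hY : IsAffine Y.left) :
    IsPushout Y.hom.appTop X.hom.appTop (snd X Y).left.appTop (fst X Y).left.appTop :=
  (isPushout_appTop_of_isPullback (IsPullback.of_hasPullback X.hom Y.hom)).flip

/-- The functions on a fibre product of affine schemes over an affine base form the tensor
product. -/
theorem exists_equiv [IsAffine S] (hX : IsAffine X.left) (hY : IsAffine Y.left) :
    ∃ μ : O Y ⊗[Γ(S, ⊤)] O X →+ O (prod X Y), Function.Bijective μ ∧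
      ∀ b a, μ (b ⊗ₜ a) = resO (snd X Y) b * resO (fst X Y) a := by
  let : Algebra (O X) (O (prod X Y)) := (resO (fst X Y)).toAlgebra
  let : Algebra (O Y) (O (prod X Y)) := (resO (snd X Y)).toAlgebra
  have : IsScalarTower Γ(S, ⊤) (O X) (O (prod X Y)) :=
    .of_algebraMap_eq fun r => (resO_algebraMap (fst X Y) r).symm
  have : IsScalarTower Γ(S, ⊤) (O Y) (O (prod X Y)) :=
    .of_algebraMap_eq fun r => (resO_algebraMap (snd X Y) r).symm
  have : Algebra.IsPushout Γ(S, ⊤) (O Y) (O X) (O (prod X Y)) :=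
    CommRingCat.isPushout_iff_isPushout.1 (isPushout X Y hX hY)
  let e := Algebra.IsPushout.equiv Γ(S, ⊤) (O Y) (O X) (O (prod X Y))
  exact ⟨(e : _ →+ _), e.bijective, fun b a => Algebra.IsPushout.equiv_tmul _ _ _ _ b a⟩

end prod

namespace OAlgebra

variable (A : OAlgebra S)

/-- The sections of `𝒜` as modules over the ring of `S`. -/
instance moduleBase (T : Over S) : Module Γ(S, ⊤) (A.Sections T) :=
  Module.compHom _ (algebraMap Γ(S, ⊤) (O T))

instance (T : Over S) : IsScalarTower Γ(S, ⊤) (O T) (A.Sections T) :=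
  ⟨fun r b a => by
    rw [Algebra.smul_def r b, mul_smul]
    rfl⟩

/-- Restriction of sections, as a linear map over the ring of `S`. -/
def resLinear {V T : Over S} (g : V ⟶ T) : A.Sections T →ₗ[Γ(S, ⊤)] A.Sections V where
  toFun := A.res g
  map_add' := map_add _
  map_smul' r a := by
    rw [← algebraMap_smul (O T) r a, res_smul, resO_algebraMap, algebraMap_smul, RingHom.id_apply]

/-- The comparison map `𝒪(Y) ⊗ 𝒜(X) → 𝒜(W)`, `b ⊗ a ↦ b|_W • a|_W`. -/
noncomputable def comparison {X Y W : Over S} (p : W ⟶ X) (q : W ⟶ Y) :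
    O Y ⊗[Γ(S, ⊤)] A.Sections X →ₗ[Γ(S, ⊤)] A.Sections W :=
  TensorProduct.lift (LinearMap.mk₂ _ (fun b a => resO q b • A.res p a)
    (fun b b' a => by rw [map_add, add_smul])
    (fun r b a => by rw [resO_smul, smul_assoc])
    (fun b a a' => by rw [map_add, smul_add])
    (fun r b a => by
      rw [show A.res p (r • a) = r • A.res p a from (A.resLinear p).map_smul r a, smul_comm]))

@[simp]
theorem comparison_tmul {X Y W : Over S} (p : W ⟶ X) (q : W ⟶ Y) (b : O Y) (a : A.Sections X) :
    A.comparison p q (b ⊗ₜ a) = resO q b • A.res p a := rfl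

variable {A}

/-- Over a split affine scheme, `𝒜` commutes with affine base change. -/
theorem Splitting.bijective_comparison [IsAffine S] {X : Over S} {n : ℕ} (φ : A.Splitting X n)
    (Y : Over S) (hX : IsAffine X.left) (hY : IsAffine Y.left) :
    Function.Bijective (A.comparison (prod.fst X Y) (prod.snd X Y)) := by
  obtain ⟨μ, hμ, hμ'⟩ := prod.exists_equiv X Y hX hY
  let ε : ∀ {V : Over S} (_ : V ⟶ X), A.Sections V ≃ₗ[Γ(S, ⊤)] (Fin n × Fin n → O V) :=
    fun {V} h => ((φ.iso h).toLinearEquiv.trans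
      (LinearEquiv.curry (O V) (O V) (Fin n) (Fin n)).symm).restrictScalars Γ(S, ⊤)
  have hε : ∀ {V : Over S} (h : V ⟶ X) (a : A.Sections V) (ij : Fin n × Fin n),
      ε h a ij = φ.iso h a ij.1 ij.2 := fun _ _ _ => rfl
  let τ := (LinearEquiv.lTensor (O Y) (ε (𝟙 X))).trans
    (TensorProduct.piRight Γ(S, ⊤) Γ(S, ⊤) (O Y) fun _ : Fin n × Fin n => O X)
  have key : ∀ x ij, ε (prod.fst X Y) (A.comparison (prod.fst X Y) (prod.snd X Y) x) ij =
      μ (τ x ij) := by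
    intro x ij
    induction x with
    | zero => simp
    | add x y hx hy =>
      rw [map_add, map_add, Pi.add_apply, hx, hy, map_add, Pi.add_apply, map_add]
    | tmul b a =>
      have h := φ.natural (prod.fst X Y) (𝟙 X) a
      rw [Category.comp_id] at h
      have h1 : τ (b ⊗ₜ a) ij = b ⊗ₜ (ε (𝟙 X) a ij) := rfl
      rw [h1, hμ', comparison_tmul, hε, hε, map_smul, h]
      rfl
  have hcomp : (ε (prod.fst X Y)) ∘ (A.comparison (prod.fst X Y) (prod.snd X Y)) =
      (fun y ij => μ (y ij)) ∘ τ := by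
    ext x ij
    exact key x ij
  have hb : Function.Bijective
      ((fun (y : Fin n × Fin n → O Y ⊗[Γ(S, ⊤)] O X) ij => μ (y ij)) ∘ τ) :=
    (Function.Bijective.piMap fun _ => hμ).comp τ.bijective
  rw [← hcomp] at hb
  exact (Function.Bijective.of_comp_iff' (ε (prod.fst X Y)).bijective _).1 hb

end OAlgebra

end FppfAlg

/-! ### Global sections over an affine base -/

namespace FppfAlg

variable {S : Scheme.{u}}

theorem hom_base_unique {T : Over S} (f g : T ⟶ OAlgebra.base S) : f = g :=
  Over.mkIdTerminal.hom_ext f g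

namespace AffineFppfCover

variable (𝒰 : AffineFppfCover S)

theorem module_flat [IsAffine S] (j : 𝒰.ι) : Module.Flat Γ(S, ⊤) (O (𝒰.U j)) := by
  have := 𝒰.flat j
  have : IsAffine (𝒰.U j).left := 𝒰.isAffine j
  exact (𝒰.U j).hom.flat_appTop

/-- Joint surjectivity on prime ideals of the rings of functions. -/
theorem exists_mem_range_comap [IsAffine S] (𝔭 : PrimeSpectrum Γ(S, ⊤)) :
    ∃ j, 𝔭 ∈ Set.range (PrimeSpectrum.comap (algebraMap Γ(S, ⊤) (O (𝒰.U j)))) := by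
  obtain ⟨j, y, hy⟩ := 𝒰.jointlySurjective (S.isoSpec.inv 𝔭)
  have : IsAffine (𝒰.U j).left := 𝒰.isAffine j
  refine ⟨j, (𝒰.U j).left.isoSpec.hom y, ?_⟩
  have h := Scheme.isoSpec_hom_naturality (𝒰.U j).hom
  have h1 : Spec.map (𝒰.U j).hom.appTop ((𝒰.U j).left.isoSpec.hom y) =
      S.isoSpec.hom ((𝒰.U j).hom y) := by
    rw [← Scheme.Hom.comp_apply, h, Scheme.Hom.comp_apply]
  have h2 : S.isoSpec.hom (S.isoSpec.inv 𝔭) = 𝔭 :=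
    congr($(S.isoSpec.inv_hom_id) 𝔭)
  rw [hy] at h1
  exact h1.trans h2

theorem ext_sections (A : OAlgebra S) {a b : A.Sections (OAlgebra.base S)}
    (h : ∀ i, A.res (𝒰.map i) a = A.res (𝒰.map i) b) : a = b := by
  refine A.eq_of_locally_eq _ 𝒰.covering a b fun V g hg => ?_
  obtain ⟨W, k, f, ⟨i⟩, rfl⟩ := hg
  rw [A.res_comp, A.res_comp, h]

theorem exists_glue_sections (A : OAlgebra S) (a : ∀ i, A.Sections (𝒰.U i))
    (h : ∀ i k, A.res (prod.fst (𝒰.U i) (𝒰.U k)) (a i) = A.res (prod.snd (𝒰.U i) (𝒰.U k)) (a k)) :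
    ∃ m : A.Sections (OAlgebra.base S), ∀ i, A.res (𝒰.map i) m = a i := by
  have hs := A.isSheaf _ 𝒰.covering
  rw [Sieve.ofArrows, ← Presieve.isSheafFor_iff_generate, Presieve.isSheafFor_arrows_iff] at hs
  obtain ⟨m, hm, -⟩ := hs a fun i k Z f g _ => by
    change A.res f (a i) = A.res g (a k)
    rw [← prod.lift_fst f g, A.res_comp, h, ← A.res_comp, prod.lift_snd]
  exact ⟨m, hm⟩

/-- If `𝒜` is split over the members of an affine covering, then it is compatible with the base
change to these members. -/
theorem bijective_comparison [IsAffine S] (A : OAlgebra S)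
    (hs : ∀ i, ∃ n, Nonempty (A.Splitting (𝒰.U i) n)) (j : 𝒰.ι) :
    Function.Bijective (A.comparison (𝒰.map j) (𝟙 (𝒰.U j))) := by
  have := 𝒰.finite
  have := 𝒰.module_flat
  have hU := 𝒰.isAffine
  choose n φ using hs
  let U₂ i k := prod (𝒰.U i) (𝒰.U k)
  let U₃ i k := prod (U₂ i k) (𝒰.U j)
  have hU₂ : ∀ i k, IsAffine (U₂ i k).left := fun i k => prod.isAffine _ _ (hU i) (hU k)
  let p₁ i k : U₂ i k ⟶ 𝒰.U i := prod.fst _ _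
  let p₂ i k : U₂ i k ⟶ 𝒰.U k := prod.snd _ _
  -- the projections of `U_i × U_k × U_j` to `U_i × U_j` and to `U_k × U_j`
  let q₁ i k : U₃ i k ⟶ U₂ i j := prod.lift (prod.fst _ _ ≫ p₁ i k) (prod.snd _ _)
  let q₂ i k : U₃ i k ⟶ U₂ k j := prod.lift (prod.fst _ _ ≫ p₂ i k) (prod.snd _ _)
  let r {V T : Over S} (g : V ⟶ T) : A.Sections T →+ A.Sections V := (A.res g : _ →+ _)
  refine bijective_of_cech (R := Γ(S, ⊤)) (B := O (𝒰.U j)) j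
    (fun i => A.resLinear (𝒰.map i)) (fun i k => A.resLinear (p₁ i k))
    (fun i k => A.resLinear (p₂ i k)) ?_ ?_
    (A.comparison (𝒰.map j) (𝟙 (𝒰.U j))).toAddMonoidHom
    (fun i => (A.comparison (p₁ i j) (p₂ i j)).toAddMonoidHom)
    (fun i k => (A.comparison (prod.fst (U₂ i k) (𝒰.U j)) (prod.snd _ _)).toAddMonoidHom)
    (fun i => (φ i).some.bijective_comparison _ (hU i) (hU j))
    (fun i k => (((φ i).some.restrict (p₁ i k)).bijective_comparison _ (hU₂ i k) (hU j)).1)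
    (fun i => r (p₂ i j)) ?_ (fun i k => r (q₁ i k)) (fun i k => r (q₂ i k)) ?_ ?_ ?_
    (r (prod.lift (𝟙 _) (𝟙 _))) ?_
  · intro m hm
    refine 𝒰.ext_sections A fun i => ?_
    rw [map_zero]
    exact hm i
  · refine fun a => ⟨𝒰.exists_glue_sections A a, ?_⟩
    rintro ⟨m, hm⟩ i k
    rw [← hm, ← hm]
    change A.res _ (A.res _ m) = A.res _ (A.res _ m)
    rw [← A.res_comp, ← A.res_comp, hom_base_unique (p₁ i k ≫ _)]
  · intro i x
    induction x with
    | zero => simp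
    | add x y hx hy => simp only [map_add, hx, hy]
    | tmul b m =>
      change resO (p₂ i j) b • A.res (p₁ i j) (A.res (𝒰.map i) m) =
        A.res (p₂ i j) (resO (𝟙 _) b • A.res (𝒰.map j) m)
      rw [OAlgebra.res_smul, resO_id, ← A.res_comp, ← A.res_comp, hom_base_unique (p₁ i j ≫ _)]
  · intro i k x
    induction x with
    | zero => simp
    | add x y hx hy => simp only [map_add, hx, hy]
    | tmul b a =>
      change resO (prod.snd (U₂ i k) (𝒰.U j)) b •
          A.res (prod.fst (U₂ i k) (𝒰.U j)) (A.res (p₁ i k) a) =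
        A.res (q₁ i k) (resO (p₂ i j) b • A.res (p₁ i j) a)
      rw [OAlgebra.res_smul, ← resO_comp, ← A.res_comp, ← A.res_comp, prod.lift_fst, prod.lift_snd]
  · intro i k x
    induction x with
    | zero => simp
    | add x y hx hy => simp only [map_add, hx, hy]
    | tmul b a =>
      change resO (prod.snd (U₂ i k) (𝒰.U j)) b •
          A.res (prod.fst (U₂ i k) (𝒰.U j)) (A.res (p₂ i k) a) =
        A.res (q₂ i k) (resO (p₂ k j) b • A.res (p₁ k j) a)
      rw [OAlgebra.res_smul, ← resO_comp, ← A.res_comp, ← A.res_comp, prod.lift_fst, prod.lift_snd]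
  · intro i k x
    change A.res _ (A.res _ x) = A.res _ (A.res _ x)
    rw [← A.res_comp, ← A.res_comp, prod.lift_snd, prod.lift_snd]
  · intro x
    change A.res _ (A.res _ x) = x
    rw [← A.res_comp, prod.lift_snd, A.res_id]

end AffineFppfCover

end FppfAlg

/-! ### Solving linear equations locally and globally -/

namespace FppfAlg

open TensorProduct
namespace OAlgebra
variable {S : Scheme.{u}} {A : OAlgebra S}

theorem res_mem_span {V T : Over S} (h : V ⟶ T) {ι : Type*} (v : ι → A.Sections T)
    {x : A.Sections T} (hx : x ∈ Submodule.span (O T) (Set.range v)) :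
    A.res h x ∈ Submodule.span (O V) (Set.range fun i => A.res h (v i)) := by
  induction hx using Submodule.span_induction with
  | mem x hx =>
    obtain ⟨i, rfl⟩ := hx
    exact Submodule.subset_span ⟨i, rfl⟩
  | zero => rw [map_zero]; exact zero_mem _
  | add x y _ _ hx hy => rw [map_add]; exact add_mem hx hy
  | smul r x _ hx => rw [res_smul]; exact Submodule.smul_mem _ _ hx

/-- An endomorphism of `𝒜` as a linear map over the ring of `S`. -/
def ModuleEnd.baseLinear (d : A.ModuleEnd) (T : Over S) :
    A.Sections T →ₗ[Γ(S, ⊤)] A.Sections T :=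
  (d.app T).restrictScalars Γ(S, ⊤)

theorem ModuleEnd.comparison_lTensor (d : A.ModuleEnd) {X Y W : Over S} (p : W ⟶ X) (q : W ⟶ Y)
    (z : O Y ⊗[Γ(S, ⊤)] A.Sections X) :
    A.comparison p q ((d.baseLinear X).lTensor (O Y) z) = d.app W (A.comparison p q z) := by
  induction z with
  | zero => simp
  | add x y hx hy => simp only [map_add, hx, hy]
  | tmul b a =>
    rw [LinearMap.lTensor_tmul, comparison_tmul, comparison_tmul, map_smul, d.natural]
    rfl

/-- Over an affine base, a global section that is a value of `d` locally on a covering where `𝒜`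
is split is a value of `d` globally. -/
theorem ModuleEnd.exists_app_eq_of_cover [IsAffine S] (d : A.ModuleEnd) (𝒰 : AffineFppfCover S)
    (hs : ∀ i, ∃ n, Nonempty (A.Splitting (𝒰.U i) n)) (y : A.Sections (base S))
    (hy : ∀ i, ∃ a, d.app (𝒰.U i) a = A.res (𝒰.map i) y) : ∃ a, d.app (base S) a = y := by
  have := 𝒰.module_flat
  refine LinearMap.mem_range_of_forall_flat _ 𝒰.exists_mem_range_comap (d.baseLinear (base S)) y
    fun j => ?_
  obtain ⟨a, ha⟩ := hy j
  have hb := 𝒰.bijective_comparison A hs j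
  obtain ⟨z, rfl⟩ := hb.2 a
  refine ⟨z, hb.1 ?_⟩
  rw [d.comparison_lTensor, ha, comparison_tmul, map_one, one_smul]

/-- For the final object, the structure map `Γ(S, ⊤) → 𝒪(S)` is the identity. -/
theorem algebraMap_base_bijective :
    Function.Bijective (algebraMap Γ(S, ⊤) (O (base S))) := by
  have h : ∀ r : Γ(S, ⊤), algebraMap Γ(S, ⊤) (O (base S)) r = r := fun r => by
    change (𝟙 S : S ⟶ S).appTop.hom r = r
    rw [Scheme.Hom.id_appTop]
    rfl
  exact ⟨fun a b hab => (h a).symm.trans (hab.trans (h b)), fun b => ⟨b, h b⟩⟩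

namespace Involution
variable {σ : A.Involution}

/-- The kernel `𝒮ym` of `Id - σ` commutes with flat base change, hence is generated over the members
of the covering by global sections. -/
theorem mem_span_res_Sym [IsAffine S] (𝒰 : AffineFppfCover S)
    (hs : ∀ i, ∃ n, Nonempty (A.Splitting (𝒰.U i) n)) (j : 𝒰.ι) {t : A.Sections (𝒰.U j)}
    (ht : t ∈ σ.Sym (𝒰.U j)) :
    t ∈ Submodule.span (O (𝒰.U j))
      (Set.range fun s : σ.Sym (base S) => A.res (𝒰.map j) (s : A.Sections (base S))) := by
  have := 𝒰.module_flat j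
  have hb := 𝒰.bijective_comparison A hs j
  obtain ⟨z, rfl⟩ := hb.2 t
  let d := σ.idSub.baseLinear (base S)
  have hex : Function.Exact (LinearMap.ker d).subtype d := fun x => by simp
  have hz : d.lTensor (O (𝒰.U j)) z = 0 := hb.1 (by
    rw [σ.idSub.comparison_lTensor, map_zero]
    exact ht)
  obtain ⟨w, rfl⟩ := (Module.Flat.lTensor_exact (O (𝒰.U j)) hex z).1 hz
  clear ht hz
  induction w with
  | zero => simp
  | add x y hx hy => rw [map_add, map_add]; exact add_mem hx hy
  | tmul b s =>
    rw [LinearMap.lTensor_tmul, comparison_tmul]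
    exact Submodule.smul_mem _ _ (Submodule.subset_span ⟨⟨s.1, s.2⟩, rfl⟩)

/-- Over an affine base, finitely many global symmetric elements generate `𝒮ym` over every scheme
mapping to a member of a covering by orthogonal splittings. -/
theorem exists_finite_generators [IsAffine S] (𝒰 : AffineFppfCover S)
    (hs : ∀ i, ∃ n, Nonempty (σ.OrthogonalSplitting (𝒰.U i) n)) :
    ∃ F : Finset (σ.Sym (base S)), ∀ (i : 𝒰.ι) ⦃V : Over S⦄ (_ : V ⟶ 𝒰.U i), ∀ t ∈ σ.Sym V,
      t ∈ Submodule.span (O V)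
        (Set.range fun s : F => A.res (toBase V) (s : A.Sections (base S))) := by
  classical
  have := 𝒰.finite
  have := Fintype.ofFinite 𝒰.ι
  choose n ψ' using hs
  let ψ i := (ψ' i).some
  have h1 : ∀ i (p : Fin (n i) × Fin (n i)), ∃ F : Finset (σ.Sym (base S)),
      ((ψ i).gen p.1 p.2 : A.Sections (𝒰.U i)) ∈ Submodule.span (O (𝒰.U i))
        ((fun s : σ.Sym (base S) => A.res (𝒰.map i) (s : A.Sections (base S))) '' F) := by
    intro i p
    have h := mem_span_res_Sym 𝒰 (fun i => ⟨n i, ⟨(ψ i).φ⟩⟩) i ((ψ i).gen p.1 p.2).2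
    obtain ⟨c, hc⟩ := Finsupp.mem_span_range_iff_exists_finsupp.1 h
    refine ⟨c.support, ?_⟩
    rw [← hc]
    exact sum_mem fun s hs => Submodule.smul_mem _ _ (Submodule.subset_span ⟨s, hs, rfl⟩)
  choose F hF using h1
  refine ⟨Finset.univ.biUnion fun i => Finset.univ.biUnion fun p => F i p, fun i V h t ht => ?_⟩
  refine Submodule.span_le.2 ?_ ((ψ i).mem_span_gen h ht)
  rintro _ ⟨p, rfl⟩
  have h2 := res_mem_span h
    (fun s : (Finset.univ.biUnion fun i => Finset.univ.biUnion fun p => F i p :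
      Finset (σ.Sym (base S))) => A.res (𝒰.map i) (s : A.Sections (base S)))
    (x := (ψ i).gen p.1 p.2) (Submodule.span_mono ?_ (hF i p))
  · simpa only [← A.res_comp, hom_base_unique (h ≫ 𝒰.map i) (toBase V), SetLike.mem_coe] using h2
  · rintro _ ⟨s, hs, rfl⟩
    exact ⟨⟨s, Finset.mem_biUnion.2 ⟨i, Finset.mem_univ _, Finset.mem_biUnion.2
      ⟨p, Finset.mem_univ _, hs⟩⟩⟩, rfl⟩

/-- The linear map `m ↦ (Trd(m s))_s`, for a finite set of global symmetric elements `s`. Its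
values are taken in `Γ(S, ⊤)`, to which `𝒪(S)` is identified. -/
noncomputable def traceForm (hA : A.IsLocallySplit) (F : Finset (σ.Sym (base S))) :
    A.Sections (base S) →ₗ[Γ(S, ⊤)] (F → Γ(S, ⊤)) :=
  LinearMap.pi fun s =>
    (LinearEquiv.ofBijective (Algebra.linearMap Γ(S, ⊤) (O (base S)))
      algebraMap_base_bijective).symm.toLinearMap ∘ₗ
    (hA.trdLinear (base S) ∘ₗ LinearMap.mulRight (O (base S))
      (s : A.Sections (base S))).restrictScalars Γ(S, ⊤)

theorem algebraMap_traceForm (hA : A.IsLocallySplit) (F : Finset (σ.Sym (base S)))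
    (m : A.Sections (base S)) (s : F) :
    algebraMap Γ(S, ⊤) (O (base S)) (traceForm hA F m s) =
      A.trd (m * (s : A.Sections (base S))) :=
  (LinearEquiv.ofBijective (Algebra.linearMap Γ(S, ⊤) (O (base S)))
      algebraMap_base_bijective).apply_symm_apply _

/-- After base change to `U` the map `traceForm` is `a ↦ (Trd(a s|_U))_s` on `𝒜(U)`. -/
theorem piScalarRight_lTensor_traceForm (hA : A.IsLocallySplit) (F : Finset (σ.Sym (base S)))
    [DecidableEq F] {U : Over S} (g : U ⟶ base S) (z : O U ⊗[Γ(S, ⊤)] A.Sections (base S)) (s : F) :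
    TensorProduct.piScalarRight Γ(S, ⊤) Γ(S, ⊤) (O U) F ((traceForm hA F).lTensor (O U) z) s =
      A.trd (A.comparison g (𝟙 U) z * A.res g (s : A.Sections (base S))) := by
  induction z with
  | zero =>
    rw [map_zero, map_zero, map_zero, zero_mul]
    exact ((hA.trdLinear U).map_zero).symm
  | add x y hx hy => simp only [map_add, Pi.add_apply, hx, hy, add_mul, hA.trd_add]
  | tmul b m =>
    rw [LinearMap.lTensor_tmul, comparison_tmul, TensorProduct.piScalarRight_apply,
      TensorProduct.piScalarRightHom_tmul, resO_id, smul_mul_assoc, hA.trd_smul, ← _root_.map_mul,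
      hA.trd_res, ← algebraMap_traceForm hA F m s, resO_algebraMap, mul_comm,
      ← Algebra.smul_def]

/-- Over an affine base every linear form on `𝒮ym` is of the form `Trd(l ·)` with a global
section `l`. -/
theorem IsOrthogonal.exists_app_eq_trd [IsAffine S] (hσ : σ.IsOrthogonal) (f : σ.SymForm) :
    ∃ l : A.Sections (base S), ∀ (T : Over S) (t : σ.Sym T),
      f.app T t = A.trd (A.res (toBase T) l * (t : A.Sections T)) := by
  classical
  have hA := hσ.isLocallySplit
  obtain ⟨R, hR, hs⟩ := hσ.exists_splitting
  obtain ⟨𝒰, h𝒰⟩ := exists_affineFppfCover R hR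
  have hψ : ∀ i, ∃ n, Nonempty (σ.OrthogonalSplitting (𝒰.U i) n) := fun i => hs _ (h𝒰 i)
  have hφ : ∀ i, ∃ n, Nonempty (A.Splitting (𝒰.U i) n) := fun i =>
    (hψ i).imp fun n ⟨ψ⟩ => ⟨ψ.φ⟩
  obtain ⟨F, hF⟩ := exists_finite_generators 𝒰 hψ
  have := 𝒰.module_flat
  choose v hv using fun s : F => algebraMap_base_bijective.2 (f.app (base S) s)
  -- It remains to solve the finitely many linear equations `Trd(l s) = f(s)` over the ring of `S`;
  -- they are solvable over the covering.
  obtain ⟨l, hl⟩ := LinearMap.mem_range_of_forall_flat _ 𝒰.exists_mem_range_comap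
    (traceForm hA F) v fun j => by
      obtain ⟨n, ⟨ψ⟩⟩ := hψ j
      obtain ⟨l, hl⟩ := ψ.exists_app_eq_trd hA f
      obtain ⟨z, hz⟩ := (𝒰.bijective_comparison A hφ j).2 l
      refine ⟨z, (TensorProduct.piScalarRight Γ(S, ⊤) Γ(S, ⊤) (O (𝒰.U j)) F).injective ?_⟩
      ext s
      rw [piScalarRight_lTensor_traceForm hA F (𝒰.map j), hz, TensorProduct.piScalarRight_apply,
        TensorProduct.piScalarRightHom_tmul]
      have h := hl (𝟙 _) ⟨A.res (𝒰.map j) (s : A.Sections (base S)), σ.res_mem_Sym _ s.1.2⟩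
      rw [A.res_id, f.natural, ← hv, resO_algebraMap] at h
      exact h.symm.trans (Algebra.algebraMap_eq_smul_one _)
  have hl' : ∀ s : F, f.app (base S) s = A.trd (l * (s : A.Sections (base S))) := fun s => by
    rw [← algebraMap_traceForm hA F l s, hl, hv]
  refine ⟨l, fun T t => ?_⟩
  refine eq_of_locally_eq_O _ ((fppf S).pullback_stable (toBase T) 𝒰.covering) _ _ ?_
  intro V g hg
  obtain ⟨W, k, m, ⟨i⟩, hk⟩ := hg
  rw [← f.natural, ← hA.trd_res, _root_.map_mul, ← A.res_comp,
    hom_base_unique (g ≫ toBase T) (toBase V)]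
  exact f.app_eq_trd_of_mem_span hA (toBase V) l (fun s : F => s.1) hl'
    ⟨A.res g t, σ.res_mem_Sym g t.2⟩ (hF i k _ (σ.res_mem_Sym g t.2))

/-- If `1` is locally of the form `a + σ(a)`, then it is so globally over an affine base. -/
theorem IsOrthogonal.exists_add_app_eq_one [IsAffine S] (hσ : σ.IsOrthogonal)
    (h1 : (1 : A.Sections (base S)) ∈ σ.Symd (base S)) :
    ∃ l : A.Sections (base S), l + σ.app (base S) l = 1 := by
  obtain ⟨R, hR, hs⟩ := hσ.isLocallySplit
  obtain ⟨R', hR', hs'⟩ := h1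
  obtain ⟨𝒰, h𝒰⟩ := exists_affineFppfCover (R ⊓ R') ((fppf S).intersection_covering hR hR')
  exact σ.idAdd.exists_app_eq_of_cover 𝒰 (fun i => hs _ (h𝒰 i).1) 1 fun i => hs' _ (h𝒰 i).2

/-! ### Linear forms and sections of the quotient sheaf -/

theorem IsOrthogonal.trd_mul_app (hσ : σ.IsOrthogonal) {T : Over S} (x a : A.Sections T) :
    A.trd (x * σ.app T a) = A.trd (σ.app T x * a) := by
  rw [← hσ.trd_app, σ.map_mul, σ.involutive, hσ.isLocallySplit.trd_mul_comm]

/-- A form `Trd(l ·)` on `𝒮ym` satisfies the defining identity of quadratic triples only if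
`l + σ(l) = 1`. -/
theorem IsOrthogonal.isRepresentedBy (hσ : σ.IsOrthogonal) {f : σ.SymForm} (hf : f.IsQuadratic)
    {l : A.Sections (base S)} (hl : ∀ (T : Over S) (t : σ.Sym T),
      f.app T t = A.trd (A.res (toBase T) l * (t : A.Sections T))) : f.IsRepresentedBy l := by
  have hA := hσ.isLocallySplit
  refine ⟨sub_eq_zero.1 (hA.eq_zero_of_trd_mul_eq_zero _ fun V g a => ?_), hl⟩
  have h := hf V a
  rw [hl, mul_add, hA.trd_add, hσ.trd_mul_app, hom_base_unique (toBase V) g] at h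
  rw [map_sub, map_add, map_one, ← σ.natural, sub_mul, add_mul, one_mul, hA.trd_sub, hA.trd_add,
    h, sub_self]

/-- The element representing a form is unique up to `𝒜ℓt`, the orthogonal complement of `𝒮ym`. -/
theorem IsOrthogonal.isRepresentedBy_iff (hσ : σ.IsOrthogonal) {f : σ.SymForm}
    {l l' : A.Sections (base S)} (hl : f.IsRepresentedBy l) :
    f.IsRepresentedBy l' ↔ l' - l ∈ σ.Alt (base S) := by
  have hA := hσ.isLocallySplit
  constructor
  · intro hl'
    refine (hσ.mem_Alt_iff _).2 fun V g t ht => ?_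
    have h := (hl.2 V ⟨t, ht⟩).symm.trans (hl'.2 V ⟨t, ht⟩)
    rw [hom_base_unique (toBase V) g] at h
    rw [map_sub, sub_mul, hA.trd_sub, h, sub_self]
  · intro h
    constructor
    · have h0 := σ.add_eq_zero_of_mem_Alt h
      rw [map_sub] at h0
      rw [← hl.1, ← sub_eq_zero, ← h0]
      abel
    · intro T t
      have h0 := (hσ.mem_Alt_iff _).1 h (toBase T) t t.2
      rw [map_sub, sub_mul, hA.trd_sub, sub_eq_zero] at h0
      rw [h0, hl.2]

theorem SymForm.ext_of_isRepresentedBy {f g : σ.SymForm} {l : A.Sections (base S)}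
    (hf : f.IsRepresentedBy l) (hg : g.IsRepresentedBy l) : f = g := by
  obtain ⟨f, hf'⟩ := f
  obtain ⟨g, hg'⟩ := g
  obtain rfl : f = g := funext fun T => LinearMap.ext fun t => (hf.2 T t).trans (hg.2 T t).symm
  rfl

section OfFamily

variable (hσ : σ.IsOrthogonal) (x : σ.QuotFamily (base S))
include hσ

/-- For a section `x` of `𝒜/𝒜ℓt` the local values `Trd(x_V t)` glue, since `𝒜ℓt` is orthogonal to
`𝒮ym`. -/
theorem IsOrthogonal.existsUnique_value {T : Over S} (t : A.Sections T) (ht : t ∈ σ.Sym T) :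
    ∃! r : O T, ∀ ⦃V : Over S⦄ (g : V ⟶ T) (hg : x.sieve (g ≫ toBase T)),
      resO g r = A.trd (x.val (g ≫ toBase T) hg * A.res g t) := by
  have hA := hσ.isLocallySplit
  have hcov := (fppf S).pullback_stable (toBase T) x.covering
  obtain ⟨r, hr⟩ := exists_glue_O (x.sieve.pullback (toBase T)) hcov
    (fun V g hg => A.trd (x.val (g ≫ toBase T) hg * A.res g t)) (by
      intro W V k g hg
      have h := (hσ.mem_Alt_iff _).1 (x.compatible k (g ≫ toBase T) hg) (𝟙 W)
        (A.res (k ≫ g) t) (σ.res_mem_Sym _ ht)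
      rw [A.res_id, sub_mul, hA.trd_sub, sub_eq_zero] at h
      rw [← hA.trd_res, _root_.map_mul, ← A.res_comp, ← h]
      congr 3)
  refine ⟨r, hr, fun r' hr' => eq_of_locally_eq_O _ hcov _ _ fun V g hg => ?_⟩
  rw [hr g hg, hr' g hg]

theorem IsOrthogonal.eq_of_value {T : Over S} {t : A.Sections T} (ht : t ∈ σ.Sym T) {r r' : O T}
    (hr : ∀ ⦃V : Over S⦄ (g : V ⟶ T) (hg : x.sieve (g ≫ toBase T)),
      resO g r = A.trd (x.val (g ≫ toBase T) hg * A.res g t))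
    (hr' : ∀ ⦃V : Over S⦄ (g : V ⟶ T) (hg : x.sieve (g ≫ toBase T)),
      resO g r' = A.trd (x.val (g ≫ toBase T) hg * A.res g t)) : r = r' :=
  (hσ.existsUnique_value x t ht).unique hr hr'

end OfFamily

/-- The linear form on `𝒮ym` given locally by `Trd(x_V ·)`. -/
noncomputable def SymForm.ofFamily (hσ : σ.IsOrthogonal) (x : σ.QuotFamily (base S)) :
    σ.SymForm where
  app T :=
    { toFun t := (hσ.existsUnique_value x t t.2).choose
      map_add' t t' := hσ.eq_of_value x (t + t').2
        (hσ.existsUnique_value x _ (t + t').2).choose_spec.1 fun V g hg => by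
          rw [_root_.map_add, (hσ.existsUnique_value x t t.2).choose_spec.1 g hg,
            (hσ.existsUnique_value x t' t'.2).choose_spec.1 g hg, ← hσ.isLocallySplit.trd_add,
            ← mul_add, ← _root_.map_add]
          rfl
      map_smul' r t := hσ.eq_of_value x (r • t).2
        (hσ.existsUnique_value x _ (r • t).2).choose_spec.1 fun V g hg => by
          rw [RingHom.id_apply, smul_eq_mul, _root_.map_mul,
            (hσ.existsUnique_value x t t.2).choose_spec.1 g hg, ← hσ.isLocallySplit.trd_smul,
            ← mul_smul_comm, ← res_smul]
          rfl }
  natural V T k t := hσ.eq_of_value x (σ.res_mem_Sym k t.2)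
    (hσ.existsUnique_value x _ (σ.res_mem_Sym k t.2)).choose_spec.1 fun W g hg => by
      have hg' : x.sieve ((g ≫ k) ≫ toBase T) := by
        rwa [hom_base_unique ((g ≫ k) ≫ toBase T) (g ≫ toBase V)]
      have h := (hσ.existsUnique_value x t t.2).choose_spec.1 (g ≫ k) hg'
      change resO g (resO k (hσ.existsUnique_value x t t.2).choose) = _
      rw [← resO_comp, h, ← A.res_comp]
      congr 3
      exact hom_base_unique _ _

/-- On the members of the covering the form attached to a family `x` is `Trd(x_V ·)`. -/
theorem SymForm.ofFamily_app (hσ : σ.IsOrthogonal) (x : σ.QuotFamily (base S)) {V : Over S}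
    (g : V ⟶ base S) (hg : x.sieve g) (t : σ.Sym V) :
    (SymForm.ofFamily hσ x).app V t = A.trd (x.val g hg * (t : A.Sections V)) := by
  obtain rfl : g = 𝟙 V ≫ toBase V := hom_base_unique _ _
  have h := (hσ.existsUnique_value x t t.2).choose_spec.1 (𝟙 V) hg
  rw [resO_id, A.res_id] at h
  exact h

/-- If `ξ(x) = 1`, then
`Trd(x (a + σ(a))) = Trd(x a) + Trd(σ(x) a) = Trd(a)`. -/
theorem SymForm.ofFamily_isQuadratic (hσ : σ.IsOrthogonal) (x : σ.QuotFamily (base S))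
    (hx : σ.xiSection x = 1) : (SymForm.ofFamily hσ x).IsQuadratic := by
  have hA := hσ.isLocallySplit
  intro T a
  refine eq_of_locally_eq_O _ ((fppf S).pullback_stable (toBase T) x.covering) _ _ ?_
  intro V g hg
  have h1 := σ.res_xiSection x (g ≫ toBase T) hg
  rw [hx, map_one] at h1
  rw [← SymForm.natural, ofFamily_app hσ x _ hg, ← hA.trd_res]
  change A.trd (_ * A.res g (a + σ.app T a)) = _
  rw [_root_.map_add, ← σ.natural, mul_add, hA.trd_add, hσ.trd_mul_app, ← hA.trd_add, ← add_mul,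
    ← h1, one_mul]

/-- A global element representing the form of the family `x` has the class of `x`. -/
theorem IsOrthogonal.toQuotAlt_eq_mk (hσ : σ.IsOrthogonal) (x : σ.QuotFamily (base S))
    {l : A.Sections (base S)} (hl : (SymForm.ofFamily hσ x).IsRepresentedBy l) :
    σ.toQuotAlt l = Quotient.mk (σ.quotSetoid (base S)) x := by
  have hA := hσ.isLocallySplit
  refine Quotient.sound fun V g _ hg => ?_
  refine (hσ.mem_Alt_iff _).2 fun W k t ht => ?_
  have h := hl.2 W ⟨t, ht⟩
  rw [SymForm.ofFamily_app hσ x (k ≫ g) (x.sieve.downward_closed hg k)] at h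
  have h' := (hσ.mem_Alt_iff _).1 (x.compatible k g hg) (𝟙 W) t ht
  rw [A.res_id, sub_mul, hA.trd_sub, h, sub_eq_zero] at h'
  rw [map_sub, sub_mul, hA.trd_sub, ← A.res_comp, hom_base_unique (k ≫ g) (toBase W), h', sub_self]

theorem toQuotAlt_eq_iff (l l' : A.Sections (base S)) :
    σ.toQuotAlt l = σ.toQuotAlt l' ↔ l - l' ∈ σ.Alt (base S) := by
  constructor
  · intro h
    have h' := Quotient.exact h (𝟙 (base S)) trivial trivial
    simpa only [A.res_id] using h'
  · intro h
    refine Quotient.sound fun V g _ _ => ?_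
    change A.res g l - A.res g l' ∈ σ.Alt V
    rw [← map_sub]
    exact σ.idSub.res_mem_image g h

theorem coe_xi_toQuotAlt (l : A.Sections (base S)) :
    (σ.xi (base S) (σ.toQuotAlt l) : A.Sections (base S)) = l + σ.app (base S) l := by
  have h := σ.res_xiSection (T := base S) { sieve := ⊤
                                            covering := (fppf S).top_mem (base S)
                                            val := fun _ g _ => A.res g l
                                            compatible := fun W V k g _ => by
                                              rw [res_comp, sub_self]
                                              exact zero_mem _ } (𝟙 _) trivial
  rw [A.res_id] at h
  refine h.trans ?_
  simp only [A.res_id]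

end Involution
end OAlgebra
end FppfAlg

theorem mainTheorem3 {S : AlgebraicGeometry.Scheme.{u}} [AlgebraicGeometry.IsAffine S]
    (A : FppfAlg.OAlgebra S) (hA : A.IsAzumayaAlgebra)
    (σ : A.Involution) (hσ : σ.IsOrthogonal) :
    (∀ f : σ.SymForm, f.IsQuadratic →
      (∃ l : A.Sections (FppfAlg.OAlgebra.base S), f.IsRepresentedBy l) ∧
      (1 : A.Sections (FppfAlg.OAlgebra.base S)) ∈ σ.Symd (FppfAlg.OAlgebra.base S)) ∧
    (∀ h1 : (1 : A.Sections (FppfAlg.OAlgebra.base S)) ∈ σ.Symd (FppfAlg.OAlgebra.base S),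
      (σ.xi (FppfAlg.OAlgebra.base S) ⁻¹' {⟨1, h1⟩}).Nonempty ∧
      (∃ Φ : {f : σ.SymForm // f.IsQuadratic} → σ.xi (FppfAlg.OAlgebra.base S) ⁻¹' {⟨1, h1⟩},
        (∀ (f : {f : σ.SymForm // f.IsQuadratic}) (l : A.Sections (FppfAlg.OAlgebra.base S)),
          f.1.IsRepresentedBy l → (Φ f : σ.QuotAlt (FppfAlg.OAlgebra.base S)) = σ.toQuotAlt l) ∧
        Function.Bijective Φ) ∧
      (∀ f : σ.SymForm, f.IsQuadratic →
        ∀ l l' : A.Sections (FppfAlg.OAlgebra.base S), f.IsRepresentedBy l →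
          (f.IsRepresentedBy l' ↔ l' - l ∈ σ.Alt (FppfAlg.OAlgebra.base S)))) := by
  have hrep : ∀ f : σ.SymForm, f.IsQuadratic →
      ∃ l : A.Sections (FppfAlg.OAlgebra.base S), f.IsRepresentedBy l := fun f hf =>
    (hσ.exists_app_eq_trd f).imp fun l hl => hσ.isRepresentedBy hf hl
  refine ⟨fun f hf => ⟨hrep f hf, ?_⟩, fun h1 => ⟨?_, ?_, fun f _ l l' hl =>
    hσ.isRepresentedBy_iff hl⟩⟩
  · obtain ⟨l, hl, -⟩ := hrep f hf
    refine ⟨⊤, (FppfAlg.fppf S).top_mem _, fun V g _ => ⟨A.res g l, ?_⟩⟩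
    rw [σ.idAdd.natural]
    exact congrArg _ hl
  · obtain ⟨l, hl⟩ := hσ.exists_add_app_eq_one h1
    exact ⟨σ.toQuotAlt l, Subtype.ext ((FppfAlg.OAlgebra.Involution.coe_xi_toQuotAlt l).trans hl)⟩
  · choose ℓ hℓ using fun f : {f : σ.SymForm // f.IsQuadratic} => hrep f.1 f.2
    refine ⟨fun f => ⟨σ.toQuotAlt (ℓ f),
      Subtype.ext ((FppfAlg.OAlgebra.Involution.coe_xi_toQuotAlt _).trans (hℓ f).1)⟩,
      fun f l hl => ?_, ?_, ?_⟩
    · exact (FppfAlg.OAlgebra.Involution.toQuotAlt_eq_iff _ _).2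
        ((hσ.isRepresentedBy_iff hl).1 (hℓ f))
    · intro f g hfg
      have hl := (FppfAlg.OAlgebra.Involution.toQuotAlt_eq_iff _ _).1 (congrArg Subtype.val hfg)
      have hrepf := (hσ.isRepresentedBy_iff (hℓ g)).2 hl
      exact Subtype.ext (FppfAlg.OAlgebra.Involution.SymForm.ext_of_isRepresentedBy (hℓ f) hrepf)
    · rintro ⟨q, hq⟩
      induction q using Quotient.inductionOn with
      | h x =>
        have hx : σ.xiSection x = 1 := congrArg Subtype.val hq
        refine ⟨⟨_, FppfAlg.OAlgebra.Involution.SymForm.ofFamily_isQuadratic hσ x hx⟩,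
          Subtype.ext ?_⟩
        exact hσ.toQuotAlt_eq_mk x (hℓ _)
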